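/- Let $X,Y,E$ be finite-dimensional Euclidean spaces, with duals $X^*,Y^*,E^*$. For a set $\Omega$ in a finite-dimensional space $Z$ and $z\in\Omega$ let $$T_\Omega(z)=\{w : \exists\, t_k\downarrow 0,\ w_k\to w,\ z+t_kw_k\in\Omega\ \forall k\}$$ be the contingent (tangent) cone; let $\widehat N_\Omega(z)=\{z^*\in Z^* : \limsup_{y\to z,\,y\in\Omega}\langle z^*,y-z\rangle/\|y-z\|\le 0\}$ be the regular normal cone, and let $N_\Omega(z)$ be the limiting normal cone, i.e. the set of all limits of sequences $z_k^*\in\widehat N_\Omega(z_k)$ with $z_k\to z$, $z_k\in\Omega$; put $N_\Omega(z)=\emptyset$ for $z\notin\Omega$. For $z^*\in N_\Omega(z)$ let $\mathcal K_\Omega(z,z^*)=\{w\in T_\Omega(z) : \langle z^*,w\rangle=0\}$ be the critical cone. The graphical derivative of a set-valued mapping $\Psi$ at $(z,u)\in\operatorname{gph}\Psi$ is $D\Psi(z,u)(w)=\{v : (w,v)\in T_{\operatorname{gph}\Psi}(z,u)\}$. Let $g:X\to Y$, let $C\subset Y$ be closed, let $\widetilde\Gamma=\{x\in X : g(x)\in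 C\}$ and $\bar x\in\widetilde\Gamma$, and suppose that $g$ is $C^2$-smooth around $\bar x$. Suppose that $C$ is $C^2$-reducible at $\bar y:=g(\bar x)$ to a closed convex cone $K\subset E$: there are an open neighborhood $V$ of $\bar y$ and a $C^2$ mapping $h:V\to E$ with $h(\bar y)=0$, $\nabla h(\bar y)$ surjective and $C\cap V=\{y\in V : h(y)\in K\}$; fix such $K$ and $h$. Let $\bar x^*\in N_{\widetilde\Gamma}(\bar x)$, and assume that the metric subregularity constraint qualification (MSCQ) holds at $\bar x$: there is $\kappa\ge 0$ with $\operatorname{dist}(x;\widetilde\Gamma)\le\kappa\operatorname{dist}(g(x);C)$ for all $x$ close to $\bar x$. For $\lambda$ in the range of the injective mapping $\nabla h(\bar y)^*$, which contains $N_C(\bar y)$, write $\mu_\lambda:=(\nabla h(\bar y)^*)^{-1}\lambda\in E^*$ and define the linear mapping $\widetilde{\mathcal H}_\lambda:X\to X^*$ by $$\widetilde{\mathcal H}_\lambda u=\nabla g(\bar x)^*\,\nabla^2\langle\mu_\lambda,h(\cdot)\rangle(\bar y)\,\nabla g(\bar x)u .$$ Let $\Lambda(\bar x,\bar x^*)=\{\lambda\in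 N_C(\bar y) : \nabla g(\bar x)^*\lambda=\bar x^*\}$ and, for $u\in X$, let $$\Lambda(\bar x,\bar x^*;u)=\operatorname*{arg\,max}_{\lambda\in\Lambda(\bar x,\bar x^*)}\Big(\langle\lambda,\nabla^2g(\bar x)(u,u)\rangle+\nabla^2\langle\mu_\lambda,h(\cdot)\rangle(\bar y)\big(\nabla g(\bar x)u,\nabla g(\bar x)u\big)\Big).$$ Then $$T_{\operatorname{gph}N_{\widetilde\Gamma}}(\bar x,\bar x^*)=\Big\{(u,u^*) : \exists\,\hat\lambda\in\Lambda(\bar x,\bar x^*;u)\ \text{with}\ u^*\in\big(\nabla^2\langle\hat\lambda,g\rangle(\bar x)+\widetilde{\mathcal H}_{\hat\lambda}\big)u+N_{\mathcal K_{\widetilde\Gamma}(\bar x,\bar x^*)}(u)\Big\},$$ and consequently, for all $u\in X$, $$DN_{\widetilde\Gamma}(\bar x,\bar x^*)(u)=\bigcup_{\hat\lambda\in\Lambda(\bar x,\bar x^*;u)}\Big(\big(\nabla^2\langle\hat\lambda,g\rangle(\bar x)+\widetilde{\mathcal H}_{\hat\lambda}\big)u+N_{\mathcal K_{\widetilde\Gamma}(\bar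 x,\bar x^*)}(u)\Big).$$ (Both right-hand sides contribute nothing for $u\notin\mathcal K_{\widetilde\Gamma}(\bar x,\bar x^*)$.) -/

import Mathlib

open Filter Topology Set

noncomputable section

namespace GraphDer

section Cones

variable {Z : Type*} [NormedAddCommGroup Z] [NormedSpace ℝ Z]

/-- The (Bouligand-Severi) tangent, or contingent, cone to `Ω` at `z`. -/
def tangentCone (Ω : Set Z) (z : Z) : Set Z :=
  {w | ∃ (t : ℕ → ℝ) (d : ℕ → Z), (∀ k, 0 < t k) ∧ Tendsto t atTop (𝓝 0) ∧
    Tendsto d atTop (𝓝 w) ∧ ∀ k, z + t k • d k ∈ Ω}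

/-- The Fréchet (regular) normal cone to `Ω` at `z`; it is empty if `z ∉ Ω`. -/
def regularNormalCone (Ω : Set Z) (z : Z) : Set (StrongDual ℝ Z) :=
  {n | z ∈ Ω ∧ ∀ ε > (0 : ℝ), ∀ᶠ y in 𝓝[Ω] z, n (y - z) ≤ ε * ‖y - z‖}

/-- The Mordukhovich (limiting) normal cone to `Ω` at `z`; it is empty if `z ∉ Ω`. -/
def normalCone (Ω : Set Z) (z : Z) : Set (StrongDual ℝ Z) :=
  {n | z ∈ Ω ∧ ∃ (y : ℕ → Z) (m : ℕ → StrongDual ℝ Z), (∀ k, m k ∈ regularNormalCone Ω (y k)) ∧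
    Tendsto y atTop (𝓝 z) ∧ Tendsto m atTop (𝓝 n)}

/-- The critical cone to `Ω` at `(z, n)`. -/
def criticalCone (Ω : Set Z) (z : Z) (n : StrongDual ℝ Z) : Set Z :=
  tangentCone Ω z ∩ {w | n w = 0}

/-- The graph of a set-valued mapping. -/
def gph {U : Type*} (Ψ : Z → Set U) : Set (Z × U) :=
  {p | p.2 ∈ Ψ p.1}

/-- The graphical derivative of a set-valued mapping `Ψ` at `(z, u)`. -/
def graphicalDerivative {U : Type*} [NormedAddCommGroup U] [NormedSpace ℝ U]
    (Ψ : Z → Set U) (z : Z) (u : U) (w : Z) : Set U :=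
  {v | (w, v) ∈ tangentCone (gph Ψ) (z, u)}

/-- At points of the set, the contingent cone is Mathlib's positive tangent cone. -/
theorem tangentCone_eq_posTangentConeAt {Ω : Set Z} {z : Z} (hz : z ∈ Ω) :
    tangentCone Ω z = posTangentConeAt Ω z := by
  ext w
  constructor
  · rintro ⟨t, d, ht, ht0, hd, hmem⟩
    refine mem_tangentConeAt_of_seq atTop (fun k => (Real.toNNReal (t k))⁻¹)
      (fun k => t k • d k) (by simpa using ht0.smul hd) (Eventually.of_forall hmem) ?_
    refine hd.congr fun k => ?_
    rw [NNReal.smul_def, NNReal.coe_inv, Real.coe_toNNReal _ (ht k).le, smul_smul,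
      inv_mul_cancel₀ (ht k).ne', one_smul]
  · intro h
    by_cases hw : w = 0
    · subst hw
      refine ⟨fun k => 1 / ((k : ℝ) + 1), fun _ => 0, fun k => by positivity,
        tendsto_one_div_add_atTop_nhds_zero_nat, tendsto_const_nhds, fun k => by simpa using hz⟩
    · obtain ⟨c, d, hd, hmem, hcd⟩ := mem_tangentConeAt_iff_exists_seq.1 h
      have hne : ∀ᶠ n in atTop, c n • d n ≠ 0 := hcd.eventually_ne hw
      have hn : Tendsto (fun n => ‖c n • d n‖) atTop (𝓝 ‖w‖) := hcd.norm
      have hc0 : Tendsto (fun n => ((c n : ℝ))⁻¹) atTop (𝓝 0) := by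
        have h1 : Tendsto (fun n => ‖d n‖ * ‖c n • d n‖⁻¹) atTop (𝓝 (0 * ‖w‖⁻¹)) := by
          refine Tendsto.mul (by simpa using hd.norm) (hn.inv₀ (by simpa using hw))
        rw [zero_mul] at h1
        refine h1.congr' ?_
        filter_upwards [hne] with n hn
        have hd0 : ‖d n‖ ≠ 0 := by
          rw [norm_ne_zero_iff]; rintro h0; exact hn (by simp [h0])
        rw [NNReal.smul_def, norm_smul, mul_inv, Real.norm_of_nonneg (c n).coe_nonneg]
        field_simp
      obtain ⟨N, hN⟩ := eventually_atTop.1 (hne.and hmem)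
      have hcp : ∀ k, (0 : ℝ) < c (k + N) := fun k => by
        have := (hN (k + N) (by omega)).1
        refine lt_of_le_of_ne (c _).coe_nonneg fun h0 => this ?_
        rw [NNReal.smul_def, ← h0, zero_smul]
      refine ⟨fun k => ((c (k + N) : ℝ))⁻¹, fun k => c (k + N) • d (k + N),
        fun k => inv_pos.2 (hcp k), (tendsto_add_atTop_iff_nat N).2 hc0,
        (tendsto_add_atTop_iff_nat (f := fun n => c n • d n) N).2 hcd, fun k => ?_⟩
      beta_reduce
      rw [NNReal.smul_def, smul_smul, inv_mul_cancel₀ (hcp k).ne', one_smul]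
      exact (hN (k + N) (by omega)).2

end Cones

section Systems

variable {X Y E : Type*} [NormedAddCommGroup X] [NormedSpace ℝ X] [NormedAddCommGroup Y]
  [NormedSpace ℝ Y] [NormedAddCommGroup E] [NormedSpace ℝ E]

/-- The second derivative `∇²f(x)`, as the bilinear mapping `(u, v) ↦ ∇²f(x)(u, v)`. For scalar `f`
it is the linear mapping `u ↦ ∇²f(x)u` from the space into its dual. -/
def second (f : X → Y) (x : X) : X →L[ℝ] X →L[ℝ] Y :=
  fderiv ℝ (fderiv ℝ f) x

/-- The closed set `C` is reduced at `y` to the closed convex cone `K` by the `C²` mapping `h`,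
which is defined on a neighborhood `V` of `y` (its values off `V` are irrelevant). -/
structure IsC2ConeReduction (C : Set Y) (y : Y) (K : ProperCone ℝ E) (h : Y → E) : Prop where
  isClosed : IsClosed C
  map_eq_zero : h y = 0
  surjective : Function.Surjective (fderiv ℝ h y)
  exists_nhds : ∃ V : Set Y, IsOpen V ∧ y ∈ V ∧ ContDiffOn ℝ 2 h V ∧
    C ∩ V = {z | z ∈ V ∧ h z ∈ K}

/-- The metric subregularity constraint qualification for `g(x) ∈ C` at `x`: metric subregularity
of `z ↦ g(z) - C` at `(x, 0)`. The distance from `0` to `g(z) - C` is that from `g(z)` to `C`. -/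
def MSCQ (g : X → Y) (C : Set Y) (x : X) : Prop :=
  ∃ κ : ℝ, 0 ≤ κ ∧ ∀ᶠ z in 𝓝 x,
    Metric.infDist z {z' | g z' ∈ C} ≤ κ * Metric.infDist (g z) C

/-- The inverse `(A*)⁻¹` of the adjoint of a surjective `A`, on the range of `A*`. -/
def adjointInv (A : Y →L[ℝ] E) : StrongDual ℝ Y → StrongDual ℝ E :=
  Function.invFun fun m : StrongDual ℝ E => m.comp A

theorem adjointInv_comp {A : Y →L[ℝ] E} (hA : Function.Surjective A) (m : StrongDual ℝ E) :
    adjointInv A (m.comp A) = m := by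
  refine Function.leftInverse_invFun (f := fun m : StrongDual ℝ E => m.comp A) ?_ m
  intro m₁ m₂ h
  ext e
  obtain ⟨y, rfl⟩ := hA e
  exact DFunLike.congr_fun h y

/-- The multiplier set `Λ(x, n)`. -/
def multipliers (g : X → Y) (C : Set Y) (x : X) (n : StrongDual ℝ X) : Set (StrongDual ℝ Y) :=
  {l | l ∈ normalCone C (g x) ∧ l.comp (fderiv ℝ g x) = n}

/-- The curvature term `u ↦ ∇g(x)* ∇²⟨(∇h(g(x))*)⁻¹ l, h⟩(g(x)) ∇g(x) u`. -/
def curvature (g : X → Y) (h : Y → E) (x : X) (l : StrongDual ℝ Y) : X →L[ℝ] StrongDual ℝ X :=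
  (second (fun y => adjointInv (fderiv ℝ h (g x)) l (h y)) (g x)).bilinearComp
    (fderiv ℝ g x) (fderiv ℝ g x)

/-- The objective `⟨l, ∇²g(x)(u, u)⟩ + ∇²⟨(∇h(g(x))*)⁻¹ l, h⟩(g(x))(∇g(x)u, ∇g(x)u)`. -/
def multiplierObjective (g : X → Y) (h : Y → E) (x u : X) (l : StrongDual ℝ Y) : ℝ :=
  l (second g x u u) +
    second (fun y => adjointInv (fderiv ℝ h (g x)) l (h y)) (g x) (fderiv ℝ g x u) (fderiv ℝ g x u)

/-- The directional multiplier set `Λ(x, n; u)`: all maximizers of the objective on `Λ(x, n)`. -/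
def directionalMultipliers (g : X → Y) (h : Y → E) (C : Set Y) (x : X) (n : StrongDual ℝ X)
    (u : X) : Set (StrongDual ℝ Y) :=
  {l | l ∈ multipliers g C x n ∧
    IsMaxOn (multiplierObjective g h x u) (multipliers g C x n) l}

end Systems

end GraphDer

end

/-!
Near `x`, the set `Γ = {z | g z ∈ C}` is described by the system `F z ∈ K` with `F = h ∘ g`, which
sends `x` to the vertex of `K`. As `∇h(g x)` is surjective, `h` is metrically regular, so MSCQ for
`g z ∈ C` passes to this system (`exists_conicSystem_preimage`), and `l = ∇h(g x)* μ` identifies the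
multipliers `l` and their objective with the elements `μ` of the polar cone of `K` with
`∇F(x)* μ = n` and with `⟨μ, ∇²F(x)(u, u)⟩` (`mem_directionalMultipliers_iff`). The theorem is thus
one about conic systems at the vertex, and both inclusions rest on a duality statement obtained from
the Hahn-Banach theorem, `exists_dual_of_le_penalty`.

Necessity. By exact penalization and duality, normals to `Γ` at points near `x` have multipliers of
norm at most `κ` times that of the normal. For normals `n + t v` at `x + t a`, with `t ↓ 0`, `a → u`
and `v → u*`, the multipliers therefore converge along a subsequence to some `μ`. Expanding
`⟨μₖ, F⟩ = 0` and `⟨μ', F⟩ ≤ 0` to second order along the sequence gives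
`⟨w, u⟩ ≥ (⟨μ', ∇²F(x)(u, u)⟩ - ⟨μ, ∇²F(x)(u, u)⟩) / 2` for `w = u* - ∇²⟨μ, F⟩(x) u` and every
multiplier `μ'`, while `w` lies in the polar of the critical cone, so that `⟨w, u⟩ ≤ 0`. Hence `μ`
is a maximizer and `w` is normal to the critical cone at `u`
(`ConicSystem.isMaxOn_of_tendsto_multiplier`).

Sufficiency. Given a maximizer `μ` and a normal `w` to the critical cone at `u`, put
`v = ∇²⟨μ, F⟩(x) u + w` and let `y` minimize `-⟨n, y⟩ / t - ⟨v, y⟩ + ρ ‖y - u‖² / 2` over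
`x + t y ∈ Γ` and `‖y - u‖ ≤ 1`. If `y` is interior to the ball, then `n + t (v - ρ (y - u))` is a
regular normal to `Γ` at `x + t y`, so it suffices that `y → u` as `t ↓ 0`. The term `-⟨n, y⟩ / t`
is asymptotically at least `⟨μ, ∇²F(x)(y, y)⟩ / 2`; that this bound is attained at `u` is the
duality between second-order tangents and multipliers (`ConicSystem.exists_recovery`), and there the
maximality of `μ` enters. For large `ρ` the limiting objective has a strict minimum over the
critical cone at `u` (`ConicSystem.mem_tangentCone_gph`).
-/

open Filter Topology Set

noncomputable section

namespace GraphDer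

/-! ### Separation -/

section Separation

variable {X E : Type*} [NormedAddCommGroup X] [NormedSpace ℝ X] [NormedAddCommGroup E]
  [NormedSpace ℝ E]

/-- Duality for the linear conic system `A z + b ∈ T`: if the penalized problem of maximizing
`⟨ξ, z⟩ - c dist (A z + b, T)` has no value above `-m`, then some `μ` in the polar of `T` with
`‖μ‖ ≤ c` and `A* μ = ξ` satisfies `m ≤ ⟨μ, b⟩`. The penalty replaces a constraint qualification:
`T` need not be closed, nor the system be feasible. -/
theorem exists_dual_of_le_penalty (A : X →L[ℝ] E) (T : PointedCone ℝ E) (b : E)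
    (ξ : StrongDual ℝ X) {m c : ℝ} (hc : 0 ≤ c)
    (H : ∀ z, ∀ p ∈ T, ξ z + m ≤ c * ‖A z + b - p‖) :
    ∃ μ : StrongDual ℝ E, (∀ p ∈ T, μ p ≤ 0) ∧ ‖μ‖ ≤ c ∧ μ.comp A = ξ ∧ m ≤ μ b := by
  -- The strict epigraph of `c dist (·, T)` is open and misses the affine set `L`.
  set S : Set (E × ℝ) := {q | ∃ p ∈ T, c * ‖q.1 - p‖ < q.2}
  set L : Set (E × ℝ) := range fun z : X => (A z + b, ξ z + m)
  have hSc : Convex ℝ S := by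
    rintro ⟨w₁, r₁⟩ ⟨p₁, hp₁, h₁⟩ ⟨w₂, r₂⟩ ⟨p₂, hp₂, h₂⟩ a₁ a₂ ha₁ ha₂ ha
    refine ⟨a₁ • p₁ + a₂ • p₂, T.convex hp₁ hp₂ ha₁ ha₂ ha, ?_⟩
    have e : a₁ • w₁ + a₂ • w₂ - (a₁ • p₁ + a₂ • p₂) = a₁ • (w₁ - p₁) + a₂ • (w₂ - p₂) := by
      module
    simp only [Prod.smul_mk, Prod.mk_add_mk, smul_eq_mul] at h₁ h₂ ⊢
    rw [e]
    have h3 : ‖a₁ • (w₁ - p₁) + a₂ • (w₂ - p₂)‖ ≤ a₁ * ‖w₁ - p₁‖ + a₂ * ‖w₂ - p₂‖ := by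
      refine (norm_add_le _ _).trans_eq ?_
      rw [norm_smul, norm_smul, Real.norm_of_nonneg ha₁, Real.norm_of_nonneg ha₂]
    have h4 := mul_le_mul_of_nonneg_left h3 hc
    rcases ha₁.eq_or_lt with rfl | hp
    · obtain rfl : a₂ = 1 := by linarith
      linarith
    · nlinarith [mul_lt_mul_of_pos_left h₁ hp, mul_le_mul_of_nonneg_left h₂.le ha₂]
  have hSo : IsOpen S := by
    have : S = ⋃ p ∈ T, {q : E × ℝ | c * ‖q.1 - p‖ < q.2} := by ext q; simp [S]
    rw [this]
    refine isOpen_biUnion fun p _ => isOpen_lt (by fun_prop) (by fun_prop)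
  have hLc : Convex ℝ L := by
    rintro _ ⟨z₁, rfl⟩ _ ⟨z₂, rfl⟩ a₁ a₂ ha₁ ha₂ ha
    refine ⟨a₁ • z₁ + a₂ • z₂, ?_⟩
    obtain rfl : a₂ = 1 - a₁ := by linarith
    ext
    · simp only [map_add, map_smul, Prod.fst_add, Prod.smul_fst]; module
    · simp only [map_add, map_smul, Prod.snd_add, Prod.smul_snd, smul_eq_mul]; ring
  have hdisj : Disjoint S L := by
    rw [Set.disjoint_left]
    rintro _ ⟨p, hp, h⟩ ⟨z, rfl⟩
    exact absurd (H z p hp) (not_le.2 h)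
  obtain ⟨f, α, hfS, hfL⟩ := geometric_hahn_banach_open hSc hSo hLc hdisj
  set μ₀ : StrongDual ℝ E := f.comp (ContinuousLinearMap.inl ℝ E ℝ)
  set ρ : ℝ := f (0, 1)
  have hf : ∀ w r, f (w, r) = μ₀ w + r * ρ := by
    intro w r
    have : ((w, r) : E × ℝ) = (w, 0) + r • (0, 1) := by ext <;> simp
    rw [this, map_add, map_smul]; simp [μ₀, ρ]
  -- `S` is a cone, so the strict bound by `α` on it sharpens to a bound by `0`.
  have hS0 : ∀ w r, ∀ p ∈ T, c * ‖w - p‖ < r → μ₀ w + r * ρ ≤ 0 := by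
    intro w r p hp h
    by_contra! hpos
    obtain ⟨s, hs⟩ := exists_nat_gt (α / (μ₀ w + r * ρ))
    have hs1 : α < (s + 1) * (μ₀ w + r * ρ) := by
      rw [div_lt_iff₀ hpos] at hs; linarith
    have hs0 : (0 : ℝ) < s + 1 := by positivity
    have hmem : (((s : ℝ) + 1) • w, ((s : ℝ) + 1) * r) ∈ S := by
      refine ⟨((s : ℝ) + 1) • p, T.smul_mem hs0.le hp, ?_⟩
      simp only
      rw [← smul_sub, norm_smul, Real.norm_of_nonneg hs0.le]
      nlinarith
    have := hfS _ hmem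
    rw [hf, map_smul, smul_eq_mul] at this
    linarith
  have hα : 0 ≤ α := by
    by_contra! hneg
    have h0 : ∀ r > 0, r * ρ < α := fun r hr => by
      have := hfS (0, r) ⟨0, T.zero_mem, by simpa using hr⟩
      simpa [hf] using this
    have h1 := h0 1 one_pos
    have hρ : ρ < 0 := by linarith
    have := h0 (α / ρ / 2) (by have := div_pos_of_neg_of_neg hneg hρ; linarith)
    have e : α / ρ / 2 * ρ = α / 2 := by rw [div_right_comm, div_mul_cancel₀ _ hρ.ne]
    linarith
  -- A functional bounded below on the affine set `L` is constant on it.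
  have hline : ∀ z, μ₀ (A z) + ξ z * ρ = 0 := by
    intro z
    by_contra hne
    set d := μ₀ (A z) + ξ z * ρ
    have := hfL _ ⟨((α - 1 - (μ₀ b + m * ρ)) / d) • z, rfl⟩
    rw [hf] at this
    simp only [map_add, map_smul, smul_eq_mul] at this
    have e : (α - 1 - (μ₀ b + m * ρ)) / d * d = α - 1 - (μ₀ b + m * ρ) := by field_simp
    simp only [d] at e
    nlinarith
  have hb : α ≤ μ₀ b + m * ρ := by
    have := hfL _ ⟨0, rfl⟩
    simpa [hf] using this
  -- If `ρ = 0`, then `f` would not separate the point of `S` above `b` from `L`.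
  have hρ : ρ < 0 := by
    have h1 := hS0 0 1 0 T.zero_mem (by simp)
    simp only [map_zero, zero_add, one_mul] at h1
    refine lt_of_le_of_ne h1 fun h0 => ?_
    have := hfS (b, c * ‖b - 0‖ + 1) ⟨0, T.zero_mem, by simp⟩
    rw [hf, h0] at this
    rw [h0] at hb
    linarith
  have hμ : ∀ w, ∀ p ∈ T, (-ρ)⁻¹ * μ₀ w ≤ c * ‖w - p‖ := by
    intro w p hp
    refine le_of_forall_pos_le_add fun ε hε => ?_
    have := hS0 w (c * ‖w - p‖ + ε) p hp (by linarith)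
    rw [inv_mul_le_iff₀ (by linarith)]
    nlinarith
  refine ⟨(-ρ)⁻¹ • μ₀, fun p hp => by simpa using hμ p p hp, ?_, ?_, ?_⟩
  · refine ContinuousLinearMap.opNorm_le_bound _ hc fun w => ?_
    have h1 := hμ w 0 T.zero_mem
    have h2 := hμ (-w) 0 T.zero_mem
    simp only [sub_zero, norm_neg, map_neg] at h1 h2
    rw [Real.norm_eq_abs, abs_le]
    simp only [smul_apply, smul_eq_mul]
    constructor <;> linarith
  · ext z
    have := hline z
    simp only [ContinuousLinearMap.comp_apply, smul_apply, smul_eq_mul]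
    rw [inv_mul_eq_iff_eq_mul₀ (by linarith)]
    linarith
  · simp only [smul_apply, smul_eq_mul]
    rw [le_inv_mul_iff₀ (by linarith)]
    linarith

end Separation

/-! ### Second-order expansions -/

section Taylor

variable {X E : Type*} [NormedAddCommGroup X] [NormedSpace ℝ X] [NormedAddCommGroup E]
  [NormedSpace ℝ E]

theorem hasFDerivAt_fderiv_second {F : X → E} {x : X} (hF : ContDiffAt ℝ 2 F x) :
    HasFDerivAt (fderiv ℝ F) (second F x) x :=
  ((hF.fderiv_right (m := 1) (by norm_num)).differentiableAt (by norm_num)).hasFDerivAt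

theorem eventually_differentiableAt {F : X → E} {x : X} (hF : ContDiffAt ℝ 2 F x) :
    ∀ᶠ y in 𝓝 x, DifferentiableAt ℝ F y :=
  (hF.eventually (by simp)).mono fun _ hy => hy.differentiableAt (by norm_num)

theorem second_comm {F : X → E} {x : X} (hF : ContDiffAt ℝ 2 F x) (v w : X) :
    second F x v w = second F x w v :=
  (hF.isSymmSndFDerivAt (by simp)).eq v w

/-- Taylor's formula of order two with the Peano remainder. -/
theorem taylor_second_isLittleO {F : X → E} {x : X} (hF : ContDiffAt ℝ 2 F x) :
    (fun d => F (x + d) - F x - fderiv ℝ F x d - (1 / 2 : ℝ) • second F x d d)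
      =o[𝓝 0] fun d => ‖d‖ ^ 2 := by
  set R : X → E := fun d => F (x + d) - F x - fderiv ℝ F x d - (1 / 2 : ℝ) • second F x d d
  rw [Asymptotics.isLittleO_iff]
  intro η hη
  have h1 : ∀ᶠ d in 𝓝 (0 : X), ‖fderiv ℝ F (x + d) - fderiv ℝ F x - second F x d‖ ≤ η * ‖d‖ :=
    Asymptotics.isLittleO_iff.1
      (hasFDerivAt_iff_isLittleO_nhds_zero.1 (hasFDerivAt_fderiv_second hF)) hη
  have h2 : ∀ᶠ d in 𝓝 (0 : X), DifferentiableAt ℝ F (x + d) := by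
    have : Tendsto (fun d => x + d) (𝓝 0) (𝓝 x) := by
      simpa using (continuous_const_add x).tendsto (0 : X)
    exact this.eventually (eventually_differentiableAt hF)
  obtain ⟨r, hr, hball⟩ := Metric.eventually_nhds_iff_ball.1 (h1.and h2)
  filter_upwards [Metric.ball_mem_nhds 0 hr] with d hd
  have hsub : Metric.closedBall (0 : X) ‖d‖ ⊆ Metric.ball 0 r :=
    Metric.closedBall_subset_ball (by simpa using hd)
  -- By symmetry of the second derivative, the derivative of the remainder is itself the first-order
  -- remainder of `∇F`.
  have hder : ∀ e ∈ Metric.closedBall (0 : X) ‖d‖, HasFDerivWithinAt R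
      (fderiv ℝ F (x + e) - fderiv ℝ F x - second F x e) (Metric.closedBall 0 ‖d‖) e := by
    intro e he
    have hFe : HasFDerivAt (fun d => F (x + d)) (fderiv ℝ F (x + e)) e := by
      have := (hball e (hsub he)).2.hasFDerivAt
      simpa using! HasFDerivAt.comp e this ((hasFDerivAt_id e).const_add x)
    have hB : HasFDerivAt (fun d => (1 / 2 : ℝ) • second F x d d) (second F x e) e := by
      have h := ((second F x).hasFDerivAt (x := e)).clm_apply (hasFDerivAt_id e)
      refine (h.const_smul (1 / 2 : ℝ)).congr_fderiv ?_
      ext v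
      simp only [smul_apply, add_apply, ContinuousLinearMap.comp_apply,
        ContinuousLinearMap.flip_apply, ContinuousLinearMap.id_apply, id, second_comm hF v e]
      module
    exact (((hFe.sub_const (F x)).sub (fderiv ℝ F x).hasFDerivAt).sub hB).hasFDerivWithinAt
  have := (convex_closedBall (0 : X) ‖d‖).norm_image_sub_le_of_norm_hasFDerivWithin_le hder
    (C := η * ‖d‖) (fun e he => (hball e (hsub he)).1.trans
      (mul_le_mul_of_nonneg_left (by simpa using he) hη.le))
    (Metric.mem_closedBall_self (norm_nonneg d)) (y := d) (by simp)
  simp only [R, add_zero, sub_self, map_zero, smul_zero, sub_zero] at this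
  simp only [R, norm_pow, norm_norm]
  linarith

variable {t : ℕ → ℝ} {y : ℕ → X} {v x : X}

theorem tendsto_add_smul_nhds (x : X) (ht : Tendsto t atTop (𝓝 0)) (hy : Tendsto y atTop (𝓝 v)) :
    Tendsto (fun k => x + t k • y k) atTop (𝓝 x) := by
  simpa using (ht.smul hy).const_add x

theorem tendsto_second_order_quotient {F : X → E} (hF : ContDiffAt ℝ 2 F x) (hF0 : F x = 0)
    (htp : ∀ k, 0 < t k) (ht : Tendsto t atTop (𝓝 0)) (hy : Tendsto y atTop (𝓝 v)) :
    Tendsto (fun k => (t k ^ 2)⁻¹ • (F (x + t k • y k) - t k • fderiv ℝ F x (y k))) atTop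
      (𝓝 ((1 / 2 : ℝ) • second F x v v)) := by
  have hd : Tendsto (fun k => t k • y k) atTop (𝓝 0) := by simpa using ht.smul hy
  have h1 := (taylor_second_isLittleO hF).comp_tendsto hd
  have h2 : (fun k => ‖t k • y k‖ ^ 2) =O[atTop] fun k => t k ^ 2 := by
    have hb : (fun k => ‖y k‖ ^ 2) =O[atTop] fun _ => (1 : ℝ) := (hy.norm.pow 2).isBigO_one ℝ
    refine ((Asymptotics.isBigO_refl (fun k => t k ^ 2) atTop).mul hb).congr
      (fun k => ?_) fun k => by simp
    rw [norm_smul, mul_pow, Real.norm_eq_abs, sq_abs]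
  have h3 := (h1.trans_isBigO h2).tendsto_inv_smul_nhds_zero
  have h4 : Tendsto (fun k => (1 / 2 : ℝ) • second F x (y k) (y k)) atTop
      (𝓝 ((1 / 2 : ℝ) • second F x v v)) :=
    ((((second F x).continuous₂.tendsto (v, v)).comp (hy.prodMk_nhds hy))).const_smul _
  have h5 := h3.add h4
  rw [zero_add] at h5
  refine h5.congr fun k => ?_
  have ht0 := (htp k).ne'
  simp only [Function.comp_apply, hF0, sub_zero, map_smul, smul_apply]
  rw [← sub_eq_zero]
  have : (t k ^ 2)⁻¹ • (t k • t k • second F x (y k) (y k)) = second F x (y k) (y k) := by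
    rw [smul_smul, smul_smul, show (t k ^ 2)⁻¹ * t k * t k = 1 by field_simp, one_smul]
  rw [smul_sub, smul_comm _ (1 / 2 : ℝ), this]
  module

/-- The first-order quotients of `F`; for `∇F` in place of `F` the limit is `second F x v`. -/
theorem tendsto_first_order_quotient {F : X → E} (hF : DifferentiableAt ℝ F x)
    (htp : ∀ k, 0 < t k) (ht : Tendsto t atTop (𝓝 0)) (hy : Tendsto y atTop (𝓝 v)) :
    Tendsto (fun k => (t k)⁻¹ • (F (x + t k • y k) - F x)) atTop (𝓝 (fderiv ℝ F x v)) := by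
  refine hF.hasFDerivAt.hasFDerivWithinAt.lim (s := univ)
    (d := fun k => t k • y k) (c := fun k => (t k)⁻¹) ?_ ?_ ?_
  · simpa using ht.smul hy
  · simp
  · refine hy.congr fun k => ?_
    rw [smul_smul, inv_mul_cancel₀ (htp k).ne', one_smul]

end Taylor

/-! ### Limits of continuous linear maps -/

section ContinuousLinearMap

variable {X Y Z : Type*} [NormedAddCommGroup X] [NormedSpace ℝ X] [NormedAddCommGroup Y]
  [NormedSpace ℝ Y] [NormedAddCommGroup Z] [NormedSpace ℝ Z]

theorem tendsto_clm_apply {α : Type*} {l : Filter α} {f : α → X →L[ℝ] Y} {a : α → X}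
    {f₀ : X →L[ℝ] Y} {a₀ : X} (hf : Tendsto f l (𝓝 f₀)) (ha : Tendsto a l (𝓝 a₀)) :
    Tendsto (fun i => f i (a i)) l (𝓝 (f₀ a₀)) :=
  (isBoundedBilinearMap_apply.continuous.tendsto (f₀, a₀)).comp (hf.prodMk_nhds ha)

theorem tendsto_clm_comp {α : Type*} {l : Filter α} {f : α → Y →L[ℝ] Z} {a : α → X →L[ℝ] Y}
    {f₀ : Y →L[ℝ] Z} {a₀ : X →L[ℝ] Y} (hf : Tendsto f l (𝓝 f₀)) (ha : Tendsto a l (𝓝 a₀)) :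
    Tendsto (fun i => (f i).comp (a i)) l (𝓝 (f₀.comp a₀)) :=
  (isBoundedBilinearMap_comp.continuous.tendsto (f₀, a₀)).comp (hf.prodMk_nhds ha)

end ContinuousLinearMap

/-! ### Normals to convex sets -/

section Convex

variable {Z : Type*} [NormedAddCommGroup Z] [NormedSpace ℝ Z]

theorem mem_regularNormalCone_of_forall_le {Ω : Set Z} {z : Z} {n : StrongDual ℝ Z} (hz : z ∈ Ω)
    (h : ∀ y ∈ Ω, n (y - z) ≤ 0) : n ∈ regularNormalCone Ω z := by
  refine ⟨hz, fun ε hε => ?_⟩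
  filter_upwards [self_mem_nhdsWithin] with y hy
  exact (h y hy).trans (by positivity)

theorem regularNormalCone_subset_normalCone {Ω : Set Z} {z : Z} :
    regularNormalCone Ω z ⊆ normalCone Ω z := fun n hn =>
  ⟨hn.1, fun _ => z, fun _ => n, fun _ => hn, tendsto_const_nhds, tendsto_const_nhds⟩

/-- A regular normal to a convex set is bounded by the slopes along segments, hence is a normal in
the sense of convex analysis. -/
theorem le_zero_of_mem_regularNormalCone {Ω : Set Z} (hΩ : Convex ℝ Ω) {z y : Z}
    {n : StrongDual ℝ Z} (hn : n ∈ regularNormalCone Ω z) (hy : y ∈ Ω) : n (y - z) ≤ 0 := by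
  suffices H : ∀ ε > 0, n (y - z) ≤ ε * ‖y - z‖ by
    refine le_of_forall_pos_le_add fun δ hδ => ?_
    refine (H (δ / (‖y - z‖ + 1)) (by positivity)).trans ?_
    rw [zero_add, div_mul_eq_mul_div, div_le_iff₀ (by positivity)]
    nlinarith [norm_nonneg (y - z)]
  intro ε hε
  have hpath : Tendsto (fun s : ℝ => z + s • (y - z)) (𝓝[>] 0) (𝓝[Ω] z) := by
    refine tendsto_nhdsWithin_iff.2 ⟨?_, ?_⟩
    · have : Continuous fun s : ℝ => z + s • (y - z) := by fun_prop
      simpa using (this.tendsto 0).mono_left nhdsWithin_le_nhds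
    · filter_upwards [Ioo_mem_nhdsGT one_pos] with s hs
      exact hΩ.add_smul_sub_mem hn.1 hy ⟨hs.1.le, hs.2.le⟩
  obtain ⟨s, hs, hs0⟩ := ((hpath.eventually (hn.2 ε hε)).and self_mem_nhdsWithin).exists
  have hs0 : 0 < s := hs0
  rw [add_sub_cancel_left, map_smul, norm_smul, Real.norm_of_nonneg hs0.le, smul_eq_mul] at hs
  nlinarith

theorem le_zero_of_mem_normalCone {Ω : Set Z} (hΩ : Convex ℝ Ω) {z y : Z}
    {n : StrongDual ℝ Z} (hn : n ∈ normalCone Ω z) (hy : y ∈ Ω) : n (y - z) ≤ 0 := by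
  obtain ⟨-, a, m, ham, ha, hm⟩ := hn
  refine le_of_tendsto (tendsto_clm_apply hm (ha.const_sub y)) (Eventually.of_forall fun k => ?_)
  exact le_zero_of_mem_regularNormalCone hΩ (ham k) hy

end Convex

/-! ### Conic systems and their multipliers -/

section System

variable {X E : Type*} [NormedAddCommGroup X] [NormedSpace ℝ X] [NormedAddCommGroup E]
  [NormedSpace ℝ E]

/-- Near `x`, the set `Γ` is described by the system `F z ∈ K` with a `C²` mapping `F` that sends
`x` to the vertex of the closed convex cone `K`, and the system is metrically subregular with
modulus `κ`. -/
structure ConicSystem (Γ : Set X) (F : X → E) (K : ProperCone ℝ E) (x : X) (κ : ℝ) : Prop where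
  contDiffAt : ContDiffAt ℝ 2 F x
  map_eq_zero : F x = 0
  mem_iff : ∀ᶠ z in 𝓝 x, z ∈ Γ ↔ F z ∈ K
  nonneg : 0 ≤ κ
  infDist_le : ∀ᶠ z in 𝓝 x, Metric.infDist z Γ ≤ κ * Metric.infDist (F z) K

/-- The multipliers of the conic system `F z ∈ K` at a point `x` with `F x = 0`: the elements `μ`
of the polar cone of `K` with `∇F(x)* μ = n`. -/
def conicMultipliers (F : X → E) (K : ProperCone ℝ E) (x : X) (n : StrongDual ℝ X) :
    Set (StrongDual ℝ E) :=
  {μ | (∀ k ∈ K, μ k ≤ 0) ∧ μ.comp (fderiv ℝ F x) = n}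

/-- The cone `K + ℝ₊ (-e)`; for `e ∈ K` its closure is the tangent cone to `K` at `e`. -/
def radialCone (K : ProperCone ℝ E) (e : E) : PointedCone ℝ E :=
  K.toPointedCone ⊔ Submodule.span _ {-e}

theorem mem_radialCone {K : ProperCone ℝ E} {e p : E} :
    p ∈ radialCone K e ↔ ∃ k ∈ K, ∃ s : ℝ, 0 ≤ s ∧ p = k - s • e := by
  rw [radialCone, Submodule.mem_sup]
  constructor
  · rintro ⟨k, hk, q, hq, rfl⟩
    obtain ⟨s, rfl⟩ := Submodule.mem_span_singleton.1 hq
    refine ⟨k, hk, s.1, s.2, ?_⟩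
    rw [sub_eq_add_neg, ← smul_neg]
    rfl
  · rintro ⟨k, hk, s, hs, rfl⟩
    refine ⟨k, hk, s • (-e), Submodule.mem_span_singleton.2 ⟨⟨s, hs⟩, rfl⟩, ?_⟩
    rw [sub_eq_add_neg, ← smul_neg]

/-- A functional that is nonpositive on the radial cone of `K` at `e ∈ K` is a normal to `K` at
`e`. -/
theorem polar_radialCone {K : ProperCone ℝ E} {e : E} (he : e ∈ K) {μ : StrongDual ℝ E}
    (hμ : ∀ p ∈ radialCone K e, μ p ≤ 0) : (∀ k ∈ K, μ k ≤ 0) ∧ μ e = 0 := by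
  have h1 : ∀ k ∈ K, μ k ≤ 0 := fun k hk =>
    hμ k (mem_radialCone.2 ⟨k, hk, 0, le_rfl, by simp⟩)
  refine ⟨h1, le_antisymm (h1 e he) ?_⟩
  have := hμ (-e) (mem_radialCone.2 ⟨0, K.zero_mem, 1, zero_le_one, by simp⟩)
  simpa using this

/-- Feasible points of `Γ` near almost feasible points: the form in which subregularity is used. -/
theorem ConicSystem.eventually_exists_near {Γ : Set X} {F : X → E} {K : ProperCone ℝ E} {x : X}
    {κ : ℝ} (S : ConicSystem Γ F K x κ) :
    ∀ᶠ z in 𝓝 x, ∀ q ∈ K, ∀ δ > 0, ∃ p ∈ Γ, ‖z - p‖ < κ * ‖F z - q‖ + δ := by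
  have hne : Γ.Nonempty := ⟨x, S.mem_iff.self_of_nhds.2 (by rw [S.map_eq_zero]; exact K.zero_mem)⟩
  filter_upwards [S.infDist_le] with z hz q hq δ hδ
  have h1 : Metric.infDist (F z) K ≤ ‖F z - q‖ := by
    rw [← dist_eq_norm]; exact Metric.infDist_le_dist_of_mem hq
  have h2 := mul_le_mul_of_nonneg_left h1 S.nonneg
  obtain ⟨p, hp, hzp⟩ := (Metric.infDist_lt_iff hne).1
    (show Metric.infDist z Γ < κ * ‖F z - q‖ + δ by linarith)
  exact ⟨p, hp, by rwa [← dist_eq_norm]⟩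

/-- Exact penalization: a regular normal to `Γ` is dominated by a multiple of the distance of the
linearized constraint to the radial cone. -/
theorem le_penalty_of_mem_regularNormalCone {Γ : Set X} {F : X → E} {K : ProperCone ℝ E} {x : X}
    {κ : ℝ} (hF : DifferentiableAt ℝ F x) (hx : F x ∈ K)
    (hE : ∀ᶠ z in 𝓝 x, ∀ q ∈ K, ∀ δ > 0, ∃ p ∈ Γ, ‖z - p‖ < κ * ‖F z - q‖ + δ)
    {m : StrongDual ℝ X} (hm : m ∈ regularNormalCone Γ x) (v : X) {p : E}
    (hp : p ∈ radialCone K (F x)) : m v ≤ κ * ‖m‖ * ‖fderiv ℝ F x v - p‖ := by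
  obtain ⟨k, hk, s, hs, rfl⟩ := mem_radialCone.1 hp
  set p := k - s • F x
  set t : ℕ → ℝ := fun j => 1 / ((j : ℝ) + 1)
  have htp : ∀ j, 0 < t j := fun j => by positivity
  have ht : Tendsto t atTop (𝓝 0) := tendsto_one_div_add_atTop_nhds_zero_nat
  set z : ℕ → X := fun j => x + t j • v
  have hz : Tendsto z atTop (𝓝 x) := tendsto_add_smul_nhds x ht tendsto_const_nhds
  set e : ℕ → ℝ := fun j => ‖(t j)⁻¹ • (F (z j) - F x) - p‖
  have he : Tendsto e atTop (𝓝 ‖fderiv ℝ F x v - p‖) :=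
    ((tendsto_first_order_quotient hF htp ht tendsto_const_nhds).sub_const p).norm
  -- The feasible point of `K` to compare with is `(1 - t s) F x + t k`.
  have hqK : ∀ᶠ j in atTop, F x + t j • p ∈ K := by
    have h1 : Tendsto (fun j => t j * s) atTop (𝓝 0) := by simpa using ht.mul_const s
    filter_upwards [h1.eventually (gt_mem_nhds one_pos)] with j hj
    have : F x + t j • p = (1 - t j * s) • F x + t j • k := by simp only [p]; module
    rw [this]
    exact K.add_mem (K.smul_mem hx (by linarith)) (K.smul_mem hk (htp j).le)
  have hex : ∀ᶠ j in atTop, ∃ a ∈ Γ, ‖z j - a‖ < t j * (κ * e j + t j) := by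
    filter_upwards [hz.eventually hE, hqK] with j hj hq
    obtain ⟨a, ha, hlt⟩ := hj _ hq (t j ^ 2) (pow_pos (htp j) 2)
    refine ⟨a, ha, hlt.trans_eq ?_⟩
    have : F (z j) - (F x + t j • p) = t j • ((t j)⁻¹ • (F (z j) - F x) - p) := by
      rw [smul_sub (t j) _ p, smul_inv_smul₀ (htp j).ne', sub_sub]
    rw [this, norm_smul, Real.norm_of_nonneg (htp j).le]
    ring
  obtain ⟨a, ha⟩ := hex.choice
  have hbound : ∀ᶠ j in atTop, ‖a j - x‖ ≤ t j * (‖v‖ + κ * e j + t j) := by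
    filter_upwards [ha] with j hj
    have h1 : a j - x = t j • v - (z j - a j) := by simp only [z]; abel
    rw [h1]
    refine (norm_sub_le _ _).trans ?_
    rw [norm_smul, Real.norm_of_nonneg (htp j).le]
    nlinarith [hj.2]
  have hlim : Tendsto (fun j => ‖v‖ + κ * e j + t j) atTop
      (𝓝 (‖v‖ + κ * ‖fderiv ℝ F x v - p‖ + 0)) := ((he.const_mul κ).const_add _).add ht
  have hax : Tendsto a atTop (𝓝[Γ] x) := by
    refine tendsto_nhdsWithin_iff.2 ⟨?_, ha.mono fun j hj => hj.1⟩
    rw [tendsto_iff_norm_sub_tendsto_zero]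
    refine squeeze_zero' (Eventually.of_forall fun _ => norm_nonneg _) hbound ?_
    simpa using ht.mul hlim
  have key : ∀ ε > 0, m v ≤ ε * (‖v‖ + κ * ‖fderiv ℝ F x v - p‖ + 0) +
      ‖m‖ * (κ * ‖fderiv ℝ F x v - p‖ + 0) := by
    intro ε hε
    refine ge_of_tendsto ((hlim.const_mul ε).add (((he.const_mul κ).add ht).const_mul ‖m‖)) ?_
    filter_upwards [ha, hbound, hax.eventually (hm.2 ε hε)] with j hj hb hr
    have h1 : t j • v = (a j - x) + (z j - a j) := by simp only [z]; abel
    have h2 : t j * m v = m (a j - x) + m (z j - a j) := by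
      rw [← map_add, ← h1, map_smul, smul_eq_mul]
    have h3 : m (z j - a j) ≤ ‖m‖ * (t j * (κ * e j + t j)) :=
      (le_abs_self _).trans ((m.le_opNorm _).trans
        (mul_le_mul_of_nonneg_left hj.2.le (norm_nonneg m)))
    have h4 := hr.trans (mul_le_mul_of_nonneg_left hb hε.le)
    refine le_of_mul_le_mul_left ?_ (htp j)
    rw [h2]
    linarith
  have hcont : Tendsto (fun ε : ℝ => ε * (‖v‖ + κ * ‖fderiv ℝ F x v - p‖ + 0) +
      ‖m‖ * (κ * ‖fderiv ℝ F x v - p‖ + 0)) (𝓝[>] 0)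
      (𝓝 (0 * (‖v‖ + κ * ‖fderiv ℝ F x v - p‖ + 0) +
        ‖m‖ * (κ * ‖fderiv ℝ F x v - p‖ + 0))) :=
    ((by fun_prop : Continuous fun ε : ℝ => ε * (‖v‖ + κ * ‖fderiv ℝ F x v - p‖ + 0) +
      ‖m‖ * (κ * ‖fderiv ℝ F x v - p‖ + 0)).tendsto 0).mono_left nhdsWithin_le_nhds
  refine (ge_of_tendsto hcont (eventually_mem_nhdsWithin.mono key)).trans_eq ?_
  ring

variable {Γ : Set X} {F : X → E} {K : ProperCone ℝ E} {x : X} {κ : ℝ}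

theorem ConicSystem.mem (S : ConicSystem Γ F K x κ) : x ∈ Γ :=
  S.mem_iff.self_of_nhds.2 (by rw [S.map_eq_zero]; exact K.zero_mem)

/-- Limiting normals near the reference point have multipliers bounded by the modulus of
subregularity, which is what makes the multipliers converge along sequences of normals. -/
theorem ConicSystem.eventually_exists_multiplier [FiniteDimensional ℝ E]
    (S : ConicSystem Γ F K x κ) :
    ∀ᶠ z in 𝓝 x, ∀ m ∈ normalCone Γ z, ∃ μ : StrongDual ℝ E, (∀ k ∈ K, μ k ≤ 0) ∧ μ (F z) = 0 ∧
      ‖μ‖ ≤ κ * ‖m‖ ∧ μ.comp (fderiv ℝ F z) = m := by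
  filter_upwards [S.mem_iff.eventually_nhds, S.eventually_exists_near.eventually_nhds,
    S.contDiffAt.eventually (by simp), (S.contDiffAt.eventually (by simp)).eventually_nhds]
    with z hz1 hz2 hz3 hz4 m hm
  obtain ⟨-, y, l, hl, hy, hlm⟩ := hm
  have hex : ∀ᶠ j in atTop, ∃ μ : StrongDual ℝ E, (∀ k ∈ K, μ k ≤ 0) ∧ μ (F (y j)) = 0 ∧
      ‖μ‖ ≤ κ * ‖l j‖ ∧ μ.comp (fderiv ℝ F (y j)) = l j := by
    filter_upwards [hy.eventually hz1, hy.eventually hz2.eventually_nhds, hy.eventually hz4]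
      with j h1 h2 h3
    have hK : F (y j) ∈ K := h1.1 (hl j).1
    obtain ⟨μ, hμT, hμn, hμ, -⟩ := exists_dual_of_le_penalty (fderiv ℝ F (y j))
      (radialCone K (F (y j))) 0 (l j) (m := 0) (c := κ * ‖l j‖)
      (mul_nonneg S.nonneg (norm_nonneg _)) fun v p hp => by
        simpa using le_penalty_of_mem_regularNormalCone (h3.differentiableAt (by norm_num)) hK h2
          (hl j) v hp
    exact ⟨μ, (polar_radialCone hK hμT).1, (polar_radialCone hK hμT).2, hμn, hμ⟩
  obtain ⟨μ, hμ⟩ := hex.choice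
  have hbd : ∀ᶠ j in atTop, μ j ∈ Metric.closedBall (0 : StrongDual ℝ E) (κ * (‖m‖ + 1)) := by
    filter_upwards [hμ, hlm.norm.eventually (gt_mem_nhds (lt_add_one ‖m‖))] with j h1 h2
    rw [mem_closedBall_zero_iff]
    exact h1.2.2.1.trans (mul_le_mul_of_nonneg_left h2.le S.nonneg)
  obtain ⟨ν, -, φ, hφ, hν⟩ :=
    tendsto_subseq_of_frequently_bounded Metric.isBounded_closedBall hbd.frequently
  have hyφ := hy.comp hφ.tendsto_atTop
  have hlφ := hlm.comp hφ.tendsto_atTop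
  have hμφ := hφ.tendsto_atTop.eventually hμ
  have hFc : ContinuousAt F z := hz3.continuousAt
  have hF'c : ContinuousAt (fderiv ℝ F) z :=
    (hz3.fderiv_right (m := 1) (by norm_num)).continuousAt
  refine ⟨ν, fun k hk => ?_, ?_, ?_, ?_⟩
  · exact le_of_tendsto (tendsto_clm_apply hν tendsto_const_nhds) (hμφ.mono fun j hj => hj.1 k hk)
  · exact tendsto_nhds_unique_of_eventuallyEq (tendsto_clm_apply hν (hFc.tendsto.comp hyφ))
      tendsto_const_nhds (hμφ.mono fun j hj => hj.2.1)
  · exact le_of_tendsto_of_tendsto hν.norm (hlφ.norm.const_mul κ) (hμφ.mono fun j hj => hj.2.2.1)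
  · exact tendsto_nhds_unique_of_eventuallyEq (tendsto_clm_comp hν (hF'c.tendsto.comp hyφ)) hlφ
      (hμφ.mono fun j hj => hj.2.2.2)

theorem ConicSystem.tangentCone_eq (S : ConicSystem Γ F K x κ) :
    tangentCone Γ x = {u | fderiv ℝ F x u ∈ K} := by
  have hd : DifferentiableAt ℝ F x := S.contDiffAt.differentiableAt (by norm_num)
  ext u
  constructor
  · rintro ⟨t, d, htp, ht, hdu, hmem⟩
    refine K.isClosed.mem_of_tendsto (tendsto_first_order_quotient hd htp ht hdu) ?_
    filter_upwards [(tendsto_add_smul_nhds x ht hdu).eventually S.mem_iff] with k hk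
    rw [S.map_eq_zero, sub_zero]
    exact K.smul_mem (hk.1 (hmem k)) (inv_nonneg.2 (htp k).le)
  · intro hu
    set t : ℕ → ℝ := fun j => 1 / ((j : ℝ) + 1)
    have htp : ∀ j, 0 < t j := fun j => by positivity
    have ht : Tendsto t atTop (𝓝 0) := tendsto_one_div_add_atTop_nhds_zero_nat
    set e : ℕ → ℝ := fun j => ‖(t j)⁻¹ • (F (x + t j • u) - F x) - fderiv ℝ F x u‖
    have he : Tendsto e atTop (𝓝 0) := by
      simpa using ((tendsto_first_order_quotient hd htp ht
        (tendsto_const_nhds (x := u))).sub_const (fderiv ℝ F x u)).norm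
    have hex : ∀ᶠ j in atTop, ∃ a ∈ Γ, ‖x + t j • u - a‖ < t j * (κ * e j + t j) := by
      filter_upwards [(tendsto_add_smul_nhds x ht tendsto_const_nhds).eventually
        S.eventually_exists_near] with j hj
      obtain ⟨a, ha, hlt⟩ := hj _ (K.smul_mem hu (htp j).le) (t j ^ 2) (pow_pos (htp j) 2)
      refine ⟨a, ha, hlt.trans_eq ?_⟩
      have : F (x + t j • u) - t j • fderiv ℝ F x u =
          t j • ((t j)⁻¹ • (F (x + t j • u) - F x) - fderiv ℝ F x u) := by
        rw [smul_sub, smul_inv_smul₀ (htp j).ne', S.map_eq_zero, sub_zero]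
      rw [this, norm_smul, Real.norm_of_nonneg (htp j).le]
      ring
    obtain ⟨N, hN⟩ := eventually_atTop.1 hex
    choose! a ha using hN
    have hs : Tendsto (fun j : ℕ => j + N) atTop atTop := tendsto_add_atTop_nat N
    refine ⟨fun j => t (j + N), fun j => (t (j + N))⁻¹ • (a (j + N) - x), fun j => htp _,
      ht.comp hs, ?_, fun j => ?_⟩
    · have hb : Tendsto (fun j => κ * e j + t j) atTop (𝓝 0) := by
        simpa using (he.const_mul κ).add ht
      rw [tendsto_iff_norm_sub_tendsto_zero]
      refine squeeze_zero (fun _ => norm_nonneg _) (fun j => ?_) (hb.comp hs)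
      have h := (ha (j + N) (by omega)).2
      set i := j + N
      have h1 : (t i)⁻¹ • (a i - x) - u = -((t i)⁻¹ • (x + t i • u - a i)) := by
        rw [← smul_neg, ← sub_eq_zero]
        have : u = (t i)⁻¹ • t i • u := (inv_smul_smul₀ (htp i).ne' u).symm
        nth_rewrite 1 [this]
        module
      rw [h1, norm_neg, norm_smul, Real.norm_of_nonneg (inv_nonneg.2 (htp i).le),
        inv_mul_le_iff₀ (htp i)]
      exact h.le
    · rw [smul_inv_smul₀ (htp _).ne', add_sub_cancel]
      exact (ha (j + N) (by omega)).1

theorem ConicSystem.mem_criticalCone (S : ConicSystem Γ F K x κ) {n : StrongDual ℝ X} {u : X} :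
    u ∈ criticalCone Γ x n ↔ fderiv ℝ F x u ∈ K ∧ n u = 0 := by
  rw [criticalCone, S.tangentCone_eq]; rfl

/-- Normals to the critical cone, which is a closed convex cone here. -/
theorem ConicSystem.mem_normalCone_criticalCone (S : ConicSystem Γ F K x κ)
    {n w : StrongDual ℝ X} {u : X} :
    w ∈ normalCone (criticalCone Γ x n) u ↔
      u ∈ criticalCone Γ x n ∧ w u = 0 ∧ ∀ v ∈ criticalCone Γ x n, w v ≤ 0 := by
  constructor
  · intro hw
    have hconv : Convex ℝ (criticalCone Γ x n) := by
      intro a ha b hb s r hs hr _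
      rw [S.mem_criticalCone] at ha hb ⊢
      simp only [map_add, map_smul, ha.2, hb.2]
      exact ⟨K.add_mem (K.smul_mem ha.1 hs) (K.smul_mem hb.1 hr), by simp⟩
    have hu := S.mem_criticalCone.1 hw.1
    have h0 := le_zero_of_mem_normalCone hconv hw (y := 0)
      (S.mem_criticalCone.2 ⟨by simp, map_zero n⟩)
    have h2 := le_zero_of_mem_normalCone hconv hw (y := (2 : ℝ) • u)
      (S.mem_criticalCone.2 ⟨by simpa using K.smul_mem hu.1 zero_le_two, by simp [hu.2]⟩)
    simp only [map_sub, map_smul, map_zero, smul_eq_mul] at h0 h2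
    have hwu : w u = 0 := by linarith
    refine ⟨hw.1, hwu, fun v hv => ?_⟩
    have := le_zero_of_mem_normalCone hconv hw hv
    rw [map_sub] at this
    linarith
  · rintro ⟨hu, hwu, hw⟩
    refine regularNormalCone_subset_normalCone
      (mem_regularNormalCone_of_forall_le hu fun y hy => ?_)
    rw [map_sub, hwu, sub_zero]
    exact hw y hy

end System

/-! ### Tangents to the graph of the normal cone mapping: necessity -/

section Necessity

variable {X E : Type*} [NormedAddCommGroup X] [NormedSpace ℝ X] [NormedAddCommGroup E]
  [NormedSpace ℝ E] {Γ : Set X} {F : X → E} {K : ProperCone ℝ E} {x : X} {κ : ℝ}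

theorem mem_tangentCone_of_eventually {Ω : Set X} {z w : X} {t : ℕ → ℝ} {d : ℕ → X}
    (htp : ∀ k, 0 < t k) (ht : Tendsto t atTop (𝓝 0)) (hd : Tendsto d atTop (𝓝 w))
    (h : ∀ᶠ k in atTop, z + t k • d k ∈ Ω) : w ∈ tangentCone Ω z := by
  obtain ⟨N, hN⟩ := eventually_atTop.1 h
  have hs : Tendsto (fun j : ℕ => j + N) atTop atTop := tendsto_add_atTop_nat N
  exact ⟨fun k => t (k + N), fun k => d (k + N), fun k => htp _, ht.comp hs, hd.comp hs,
    fun k => hN _ (by omega)⟩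

/-- The second-order part of the argument, for normals `n + t v` at `x + t u` that come with
convergent multipliers. Comparing `⟨μ, F⟩` with `⟨μ', F⟩` for another multiplier `μ'` along the
sequence yields `⟨w, u⟩ ≥ (⟨μ', ∇²F(u, u)⟩ - ⟨μ, ∇²F(u, u)⟩) / 2`, while `⟨w, u⟩ ≤ 0`. -/
theorem ConicSystem.isMaxOn_of_tendsto_multiplier (S : ConicSystem Γ F K x κ)
    {n v : StrongDual ℝ X} {u : X} {t : ℕ → ℝ} {a : ℕ → X} {b : ℕ → StrongDual ℝ X}
    {m : ℕ → StrongDual ℝ E} {μ : StrongDual ℝ E} (htp : ∀ k, 0 < t k)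
    (ht : Tendsto t atTop (𝓝 0)) (ha : Tendsto a atTop (𝓝 u)) (hb : Tendsto b atTop (𝓝 v))
    (hm : Tendsto m atTop (𝓝 μ)) (hΓ : ∀ k, x + t k • a k ∈ Γ)
    (H : ∀ᶠ k in atTop, (∀ e ∈ K, m k e ≤ 0) ∧ m k (F (x + t k • a k)) = 0 ∧
      (m k).comp (fderiv ℝ F (x + t k • a k)) = n + t k • b k) :
    μ ∈ conicMultipliers F K x n ∧
      IsMaxOn (fun μ' : StrongDual ℝ E => μ' (second F x u u)) (conicMultipliers F K x n) μ ∧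
      v - μ.comp (second F x u) ∈ normalCone (criticalCone Γ x n) u := by
  set A := fderiv ℝ F x
  have hFx : DifferentiableAt ℝ F x := S.contDiffAt.differentiableAt (by norm_num)
  have hxk := tendsto_add_smul_nhds x ht ha
  have hF'c : ContinuousAt (fderiv ℝ F) x :=
    (S.contDiffAt.fderiv_right (m := 1) (by norm_num)).continuousAt
  have hmul : μ ∈ conicMultipliers F K x n := by
    refine ⟨fun e he => le_of_tendsto (tendsto_clm_apply hm tendsto_const_nhds)
      (H.mono fun k hk => hk.1 e he), ?_⟩
    refine tendsto_nhds_unique_of_eventuallyEq (tendsto_clm_comp hm (hF'c.tendsto.comp hxk)) ?_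
      (H.mono fun k hk => hk.2.2)
    simpa using (ht.smul hb).const_add n
  have hAu : A u ∈ K := by
    have : u ∈ tangentCone Γ x := ⟨t, a, htp, ht, ha, hΓ⟩
    rwa [S.tangentCone_eq] at this
  have hnA : ∀ μ' ∈ conicMultipliers F K x n, ∀ z, μ' (A z) = n z := fun μ' h z =>
    DFunLike.congr_fun h.2 z
  have hnu : n u = 0 := by
    rw [← hnA μ hmul]
    refine tendsto_nhds_unique_of_eventuallyEq
      (tendsto_clm_apply hm (tendsto_first_order_quotient hFx htp ht ha)) tendsto_const_nhds
      (H.mono fun k hk => ?_)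
    simp only [S.map_eq_zero, sub_zero, map_smul, hk.2.1, smul_zero]
  have hcrit : u ∈ criticalCone Γ x n := S.mem_criticalCone.2 ⟨hAu, hnu⟩
  set Q : ℕ → X →L[ℝ] E := fun k => (t k)⁻¹ • (fderiv ℝ F (x + t k • a k) - A)
  have hQ : Tendsto Q atTop (𝓝 (second F x u)) :=
    tendsto_first_order_quotient (hasFDerivAt_fderiv_second S.contDiffAt).differentiableAt htp ht ha
  have hw : Tendsto (fun k => b k - (m k).comp (Q k)) atTop (𝓝 (v - μ.comp (second F x u))) :=
    hb.sub (tendsto_clm_comp hm hQ)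
  have hwk : ∀ᶠ k in atTop, ∀ z, (b k - (m k).comp (Q k)) z = (t k)⁻¹ * (m k (A z) - n z) := by
    filter_upwards [H] with k hk z
    have h1 : m k (fderiv ℝ F (x + t k • a k) z) = n z + t k * b k z := by
      simpa using DFunLike.congr_fun hk.2.2 z
    have ht0 := (htp k).ne'
    simp only [Q, sub_apply, ContinuousLinearMap.comp_apply, smul_apply, map_smul, map_sub, h1,
      smul_eq_mul]
    field_simp
    ring
  have hpolar : ∀ z ∈ criticalCone Γ x n, (v - μ.comp (second F x u)) z ≤ 0 := by
    intro z hz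
    rw [S.mem_criticalCone] at hz
    refine le_of_tendsto (tendsto_clm_apply hw tendsto_const_nhds) ?_
    filter_upwards [H, hwk] with k hk hk'
    rw [hk' z, hz.2, sub_zero]
    exact mul_nonpos_of_nonneg_of_nonpos (inv_nonneg.2 (htp k).le) (hk.1 _ hz.1)
  have hq : Tendsto (fun k => (t k ^ 2)⁻¹ • (F (x + t k • a k) - t k • A (a k))) atTop
      (𝓝 ((1 / 2 : ℝ) • second F x u u)) :=
    tendsto_second_order_quotient S.contDiffAt S.map_eq_zero htp ht ha
  -- Compare `⟨μ', F⟩ ≤ 0` with `⟨m k, F⟩ = 0` after division by `t²`.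
  have hlower : ∀ μ' ∈ conicMultipliers F K x n,
      1 / 2 * (μ' (second F x u u) - μ (second F x u u)) ≤ (v - μ.comp (second F x u)) u := by
    intro μ' hμ'
    have h1 := ((μ'.continuous.tendsto _).comp hq).sub (tendsto_clm_apply hm hq)
    have h2 : μ' ((1 / 2 : ℝ) • second F x u u) - μ ((1 / 2 : ℝ) • second F x u u) =
        1 / 2 * (μ' (second F x u u) - μ (second F x u u)) := by
      simp only [map_smul, smul_eq_mul]; ring
    rw [h2] at h1
    refine le_of_tendsto_of_tendsto h1 (tendsto_clm_apply hw ha) ?_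
    filter_upwards [H, hwk, hxk.eventually S.mem_iff] with k hk hk' hΓk
    have h3 : μ' (F (x + t k • a k)) ≤ 0 := hμ'.1 _ (hΓk.1 (hΓ k))
    have ht0 := htp k
    simp only [Function.comp_apply, map_smul, map_sub, hk.2.1, hnA μ' hμ', hk' (a k), smul_eq_mul]
    have h4 : (t k ^ 2)⁻¹ * μ' (F (x + t k • a k)) ≤ 0 :=
      mul_nonpos_of_nonneg_of_nonpos (by positivity) h3
    have h5 : ∀ r : ℝ, (t k ^ 2)⁻¹ * (t k * r) = (t k)⁻¹ * r := fun r => by field_simp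
    rw [mul_sub, mul_sub, mul_sub, h5, h5]
    linarith
  refine ⟨hmul, fun μ' hμ' => ?_, S.mem_normalCone_criticalCone.2 ⟨hcrit, ?_, hpolar⟩⟩
  · have h1 := hlower μ' hμ'
    have h2 := hpolar u hcrit
    simp only [mem_ofPred_eq]
    linarith
  · have := hlower μ hmul
    rw [sub_self, mul_zero] at this
    exact le_antisymm (hpolar u hcrit) this

theorem ConicSystem.exists_multiplier_of_mem_tangentCone_gph [FiniteDimensional ℝ E]
    (S : ConicSystem Γ F K x κ) {n v : StrongDual ℝ X} {u : X}
    (h : (u, v) ∈ tangentCone (gph (normalCone Γ)) (x, n)) :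
    ∃ μ ∈ conicMultipliers F K x n,
      IsMaxOn (fun μ' : StrongDual ℝ E => μ' (second F x u u)) (conicMultipliers F K x n) μ ∧
      v - μ.comp (second F x u) ∈ normalCone (criticalCone Γ x n) u := by
  obtain ⟨t, d, htp, ht, hd, hmem⟩ := h
  have ha : Tendsto (fun k => (d k).1) atTop (𝓝 u) := (continuous_fst.tendsto _).comp hd
  have hb : Tendsto (fun k => (d k).2) atTop (𝓝 v) := (continuous_snd.tendsto _).comp hd
  have hmem' : ∀ k, n + t k • (d k).2 ∈ normalCone Γ (x + t k • (d k).1) := hmem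
  have hnk : Tendsto (fun k => n + t k • (d k).2) atTop (𝓝 n) := tendsto_add_smul_nhds n ht hb
  obtain ⟨m, hm⟩ := (((tendsto_add_smul_nhds x ht ha).eventually
    S.eventually_exists_multiplier).mono fun k hk => hk _ (hmem' k)).choice
  have hbd : ∀ᶠ j in atTop, m j ∈ Metric.closedBall (0 : StrongDual ℝ E) (κ * (‖n‖ + 1)) := by
    filter_upwards [hm, hnk.norm.eventually (gt_mem_nhds (lt_add_one ‖n‖))] with j h1 h2
    rw [mem_closedBall_zero_iff]
    exact h1.2.2.1.trans (mul_le_mul_of_nonneg_left h2.le S.nonneg)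
  obtain ⟨μ, -, φ, hφ, hμ⟩ :=
    tendsto_subseq_of_frequently_bounded Metric.isBounded_closedBall hbd.frequently
  have hφt := hφ.tendsto_atTop
  exact ⟨μ, S.isMaxOn_of_tendsto_multiplier (fun k => htp (φ k)) (ht.comp hφt) (ha.comp hφt)
    (hb.comp hφt) hμ (fun k => (hmem' (φ k)).1)
    ((hφt.eventually hm).mono fun k hk => ⟨hk.1, hk.2.1, hk.2.2.2⟩)⟩

end Necessity

/-! ### Tangents to the graph of the normal cone mapping: sufficiency -/

section Sufficiency

variable {X E : Type*} [NormedAddCommGroup X] [NormedAddCommGroup E] [NormedSpace ℝ E]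
  {Γ : Set X} {F : X → E} {K : ProperCone ℝ E} {x : X} {κ : ℝ}

/-- Recovery sequences: duality provides a second-order correction `z` of the arc `x + t u` along
which `⟨n, ·⟩` is almost as large as any multiplier permits, and subregularity moves the corrected
arc into `Γ`. -/
theorem ConicSystem.exists_recovery [NormedSpace ℝ X] (S : ConicSystem Γ F K x κ)
    {n : StrongDual ℝ X} {u : X}
    (hu : u ∈ criticalCone Γ x n) {M : ℝ}
    (hM : ∀ μ ∈ conicMultipliers F K x n, μ (second F x u u) ≤ M) {δ : ℝ} (hδ : 0 < δ)
    {t : ℕ → ℝ} (htp : ∀ k, 0 < t k) (ht : Tendsto t atTop (𝓝 0)) :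
    ∃ y : ℕ → X, Tendsto y atTop (𝓝 u) ∧
      ∀ᶠ k in atTop, x + t k • y k ∈ Γ ∧ -n (y k) ≤ t k * (M / 2 + δ) := by
  obtain ⟨hAu, hnu⟩ := S.mem_criticalCone.1 hu
  set A := fderiv ℝ F x
  set b := second F x u u
  -- Otherwise duality produces a multiplier with an objective value of at least `M + δ`.
  have hz : ∃ z, ∃ p ∈ radialCone K (A u), κ * ‖n‖ * ‖A z + b - p‖ < n z + (M + δ) := by
    by_contra! hcon
    obtain ⟨μ, hμT, -, hμA, hμb⟩ := exists_dual_of_le_penalty A (radialCone K (A u)) b n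
      (mul_nonneg S.nonneg (norm_nonneg n)) hcon
    linarith [hM μ ⟨(polar_radialCone hAu hμT).1, hμA⟩]
  obtain ⟨z, p, hp, hlt⟩ := hz
  obtain ⟨k₀, hk₀, s, hs, rfl⟩ := mem_radialCone.1 hp
  set p := k₀ - s • A u
  set a : ℕ → X := fun k => u + t k • (1 / 2 : ℝ) • z
  have ha : Tendsto a atTop (𝓝 u) := tendsto_add_smul_nhds u ht tendsto_const_nhds
  set q : ℕ → E := fun k => (t k ^ 2)⁻¹ • (F (x + t k • a k) - t k • A (a k))
  have hq : Tendsto q atTop (𝓝 ((1 / 2 : ℝ) • b)) :=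
    tendsto_second_order_quotient S.contDiffAt S.map_eq_zero htp ht ha
  set e : ℕ → ℝ := fun k => ‖(1 / 2 : ℝ) • A z + q k - (1 / 2 : ℝ) • p‖
  have he : Tendsto e atTop (𝓝 (1 / 2 * ‖A z + b - p‖)) := by
    have h1 := ((hq.const_add ((1 / 2 : ℝ) • A z)).sub_const ((1 / 2 : ℝ) • p)).norm
    rwa [← smul_add, ← smul_sub, norm_smul, Real.norm_of_nonneg (by norm_num)] at h1
  have hK : ∀ᶠ k in atTop, t k • A u + t k ^ 2 • (1 / 2 : ℝ) • p ∈ K := by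
    have h1 : Tendsto (fun k => t k * s / 2) atTop (𝓝 0) := by
      simpa using (ht.mul_const s).div_const 2
    filter_upwards [h1.eventually (gt_mem_nhds one_pos)] with k hk
    have h2 : t k • A u + t k ^ 2 • (1 / 2 : ℝ) • p =
        (t k * (1 - t k * s / 2)) • A u + (t k ^ 2 / 2) • k₀ := by
      simp only [p]; module
    rw [h2]
    exact K.add_mem (K.smul_mem hAu (mul_nonneg (htp k).le (by linarith)))
      (K.smul_mem hk₀ (by positivity))
  have hex : ∀ᶠ k in atTop, ∃ y, x + t k • y ∈ Γ ∧ ‖a k - y‖ ≤ t k * (κ * e k + t k) := by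
    filter_upwards [(tendsto_add_smul_nhds x ht ha).eventually S.eventually_exists_near, hK]
      with k h1 h2
    have ht0 := htp k
    obtain ⟨c, hc, hlt⟩ := h1 _ h2 (t k ^ 3) (by positivity)
    refine ⟨(t k)⁻¹ • (c - x), by rwa [smul_inv_smul₀ ht0.ne', add_sub_cancel], ?_⟩
    have h3 : F (x + t k • a k) - (t k • A u + t k ^ 2 • (1 / 2 : ℝ) • p) =
        t k ^ 2 • ((1 / 2 : ℝ) • A z + q k - (1 / 2 : ℝ) • p) := by
      have h4 : F (x + t k • a k) = t k ^ 2 • q k + t k • A (a k) := by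
        simp only [q]; rw [smul_inv_smul₀ (by positivity), sub_add_cancel]
      rw [h4]
      simp only [a, map_add, map_smul]
      module
    rw [h3, norm_smul, Real.norm_of_nonneg (by positivity)] at hlt
    have h5 : a k - (t k)⁻¹ • (c - x) = (t k)⁻¹ • (x + t k • a k - c) := by
      have : a k = (t k)⁻¹ • t k • a k := (inv_smul_smul₀ ht0.ne' _).symm
      nth_rewrite 1 [this]
      module
    rw [h5, norm_smul, Real.norm_of_nonneg (inv_nonneg.2 ht0.le), inv_mul_le_iff₀ ht0]
    refine hlt.le.trans_eq ?_
    simp only [e]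
    ring
  obtain ⟨y, hy⟩ := hex.choice
  have hgap : Tendsto (fun k => κ * e k + t k) atTop (𝓝 (κ * (1 / 2 * ‖A z + b - p‖) + 0)) :=
    (he.const_mul κ).add ht
  refine ⟨y, ?_, ?_⟩
  · have h1 : Tendsto (fun k => a k - y k) atTop (𝓝 0) := by
      refine squeeze_zero_norm' (hy.mono fun k hk => hk.2) ?_
      simpa using ht.mul hgap
    simpa using ha.sub h1
  · have hlim : Tendsto (fun k => -(1 / 2 * n z) + ‖n‖ * (κ * e k + t k)) atTop
        (𝓝 (-(1 / 2 * n z) + ‖n‖ * (κ * (1 / 2 * ‖A z + b - p‖) + 0))) :=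
      (hgap.const_mul _).const_add _
    have hlt' : -(1 / 2 * n z) + ‖n‖ * (κ * (1 / 2 * ‖A z + b - p‖) + 0) < M / 2 + δ := by
      linarith
    filter_upwards [hy, hlim.eventually (gt_mem_nhds hlt')] with k hk hk'
    refine ⟨hk.1, ?_⟩
    have h1 : n (a k - y k) ≤ ‖n‖ * (t k * (κ * e k + t k)) :=
      (le_abs_self _).trans ((n.le_opNorm _).trans
        (mul_le_mul_of_nonneg_left hk.2 (norm_nonneg n)))
    have h2 : n (a k) = t k * (1 / 2 * n z) := by simp [a, hnu]
    rw [map_sub, h2] at h1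
    have h3 := mul_le_mul_of_nonneg_left hk'.le (htp k).le
    linarith

theorem mem_regularNormalCone_of_le_sq [NormedSpace ℝ X] {Ω : Set X} {z : X} {n : StrongDual ℝ X}
    {c : ℝ} (hz : z ∈ Ω)
    (h : ∀ᶠ y in 𝓝[Ω] z, n (y - z) ≤ c * ‖y - z‖ ^ 2) : n ∈ regularNormalCone Ω z := by
  refine ⟨hz, fun ε hε => ?_⟩
  have h1 : Tendsto (fun y => c * ‖y - z‖) (𝓝[Ω] z) (𝓝 0) := by
    have : Continuous fun y => c * ‖y - z‖ := by fun_prop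
    simpa using (this.tendsto z).mono_left nhdsWithin_le_nhds
  filter_upwards [h, h1.eventually (gt_mem_nhds hε)] with y hy hy'
  nlinarith [norm_nonneg (y - z)]

variable [InnerProductSpace ℝ X]

/-- The optimality condition for the proximal problem of minimizing
`-⟨n, y⟩ / t - ⟨v, y⟩ + ρ ‖y - u‖² / 2` over `x + t y ∈ Γ`, with the objective multiplied by `t`. -/
theorem mem_regularNormalCone_of_forall_ge {n v : StrongDual ℝ X} {u y : X} {t ρ r : ℝ}
    (ht : 0 < t) (hy : x + t • y ∈ Γ) (hyr : ‖y - u‖ < r)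
    (hmin : ∀ y', ‖y' - u‖ ≤ r → x + t • y' ∈ Γ →
      -n y - t * v y + t * (ρ / 2 * ‖y - u‖ ^ 2) ≤
        -n y' - t * v y' + t * (ρ / 2 * ‖y' - u‖ ^ 2)) :
    n + t • (v - ρ • innerSL ℝ (y - u)) ∈ regularNormalCone Γ (x + t • y) := by
  refine mem_regularNormalCone_of_le_sq (c := ρ / 2) hy ?_
  have hc : Continuous fun z : X => ‖t⁻¹ • (z - x) - u‖ := by fun_prop
  have h1 : ∀ᶠ z in 𝓝 (x + t • y), ‖t⁻¹ • (z - x) - u‖ < r :=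
    (hc.tendsto _).eventually (gt_mem_nhds (by simpa [inv_smul_smul₀ ht.ne'] using hyr))
  filter_upwards [h1.filter_mono nhdsWithin_le_nhds, self_mem_nhdsWithin] with z hz hzΓ
  obtain ⟨d, rfl⟩ : ∃ d, z = x + t • (y + d) :=
    ⟨t⁻¹ • (z - x) - y, by rw [add_sub_cancel, smul_inv_smul₀ ht.ne', add_sub_cancel]⟩
  rw [add_sub_cancel_left, inv_smul_smul₀ ht.ne'] at hz
  have h2 := hmin _ hz.le hzΓ
  have h3 : ‖y + d - u‖ ^ 2 = ‖y - u‖ ^ 2 + 2 * inner ℝ (y - u) d + ‖d‖ ^ 2 := by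
    rw [← norm_add_sq_real]; congr 2; abel
  have h4 : x + t • (y + d) - (x + t • y) = t • d := by module
  rw [h3, map_add, map_add] at h2
  rw [h4, norm_smul, Real.norm_of_nonneg ht.le]
  simp only [add_apply, sub_apply, smul_apply, map_smul, smul_eq_mul, innerSL_apply_apply]
  nlinarith

/-- Solutions `y` of the proximal problems converge to `u`, because the quadratic growth of the
limiting objective at `u` over the critical cone survives in the limit. -/
theorem ConicSystem.mem_tangentCone_gph [FiniteDimensional ℝ X] (S : ConicSystem Γ F K x κ)
    {n w : StrongDual ℝ X} {u : X} {μ : StrongDual ℝ E} (hμ : μ ∈ conicMultipliers F K x n)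
    (hmax : IsMaxOn (fun μ' : StrongDual ℝ E => μ' (second F x u u)) (conicMultipliers F K x n) μ)
    (hw : w ∈ normalCone (criticalCone Γ x n) u) :
    (u, μ.comp (second F x u) + w) ∈ tangentCone (gph (normalCone Γ)) (x, n) := by
  obtain ⟨hu, hwu, hwp⟩ := S.mem_normalCone_criticalCone.1 hw
  set B := second F x
  set M := μ (B u u)
  set v := μ.comp (B u) + w
  -- With this `ρ`, the limiting objective grows by at least `‖y - u‖² / 2` on the critical cone.
  set ρ : ℝ := ‖μ‖ * ‖B‖ + 1
  have hvu : v u = M := by simp [v, M, hwu]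
  have hnA : ∀ z, μ (fderiv ℝ F x z) = n z := fun z => DFunLike.congr_fun hμ.2 z
  set t : ℕ → ℝ := fun j => 1 / ((j : ℝ) + 1)
  have htp : ∀ j, 0 < t j := fun j => by positivity
  have ht : Tendsto t atTop (𝓝 0) := tendsto_one_div_add_atTop_nhds_zero_nat
  have hrec := fun (δ : ℝ) (hδ : 0 < δ) => S.exists_recovery hu hmax hδ htp ht
  -- Restricting the problems to the unit ball around `u` gives compactness; the limit shows that
  -- the restriction is inactive.
  set f : ℕ → X → ℝ := fun k y => -n y - t k * v y + t k * (ρ / 2 * ‖y - u‖ ^ 2)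
  have hsol : ∀ᶠ k in atTop, ∃ y, ‖y - u‖ ≤ 1 ∧ x + t k • y ∈ Γ ∧
      ∀ y', ‖y' - u‖ ≤ 1 → x + t k • y' ∈ Γ → f k y ≤ f k y' := by
    have hloc : ∀ᶠ z in 𝓝 x, (z ∈ Γ ↔ F z ∈ K) ∧ ContinuousAt F z :=
      S.mem_iff.and ((S.contDiffAt.eventually (by simp)).mono fun z hz => hz.continuousAt)
    obtain ⟨r, hr, hball⟩ := Metric.eventually_nhds_iff_ball.1 hloc
    obtain ⟨y₀, hy₀u, hy₀⟩ := hrec 1 one_pos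
    have hsmall : Tendsto (fun k => t k * (‖u‖ + 1)) atTop (𝓝 0) := by
      simpa using ht.mul_const (‖u‖ + 1)
    have hy₀1 : ∀ᶠ k in atTop, ‖y₀ k - u‖ < 1 :=
      (tendsto_iff_norm_sub_tendsto_zero.1 hy₀u).eventually (gt_mem_nhds one_pos)
    filter_upwards [hsmall.eventually (gt_mem_nhds hr), hy₀, hy₀1] with k hk hk' hk''
    have hin : ∀ y ∈ Metric.closedBall u 1, x + t k • y ∈ Metric.ball x r := by
      intro y hy
      rw [mem_closedBall_iff_norm] at hy
      rw [mem_ball_iff_norm, add_sub_cancel_left, norm_smul, Real.norm_of_nonneg (htp k).le]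
      refine lt_of_le_of_lt (mul_le_mul_of_nonneg_left ?_ (htp k).le) hk
      calc ‖y‖ = ‖u + (y - u)‖ := by rw [add_sub_cancel]
        _ ≤ ‖u‖ + 1 := (norm_add_le _ _).trans (by linarith)
    have hcont : ContinuousOn (fun y => F (x + t k • y)) (Metric.closedBall u 1) := by
      intro y hy
      have h1 : ContinuousAt F (x + t k • y) := (hball _ (hin y hy)).2
      have h2 : ContinuousAt (fun y => x + t k • y) y := by fun_prop
      exact (ContinuousAt.comp (f := fun y => x + t k • y) h1 h2).continuousWithinAt
    have hcomp : IsCompact (Metric.closedBall u 1 ∩ (fun y => F (x + t k • y)) ⁻¹' K) :=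
      (isCompact_closedBall u 1).of_isClosed_subset
        (hcont.preimage_isClosed_of_isClosed Metric.isClosed_closedBall K.isClosed)
        inter_subset_left
    have hy₀mem : y₀ k ∈ Metric.closedBall u 1 := mem_closedBall_iff_norm.2 hk''.le
    obtain ⟨y, ⟨hy1, hyK⟩, hymin⟩ := hcomp.exists_isMinOn
      ⟨y₀ k, hy₀mem, (hball _ (hin _ hy₀mem)).1.1 hk'.1⟩
      (f := f k) (by fun_prop : Continuous (f k)).continuousOn
    refine ⟨y, mem_closedBall_iff_norm.1 hy1, (hball _ (hin y hy1)).1.2 hyK, fun y' h1 h2 => ?_⟩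
    have h1' : y' ∈ Metric.closedBall u 1 := mem_closedBall_iff_norm.2 h1
    exact hymin ⟨h1', (hball _ (hin y' h1')).1.1 h2⟩
  obtain ⟨y, hy⟩ := hsol.choice
  obtain ⟨ybar, -, φ, hφ, hyφ⟩ := tendsto_subseq_of_frequently_bounded
    (Metric.isBounded_closedBall (x := u) (r := 1)) (x := y)
    (hy.mono fun k hk => mem_closedBall_iff_norm.2 hk.1).frequently
  have hφt := hφ.tendsto_atTop
  have hsp : ∀ k, 0 < t (φ k) := fun k => htp _
  have hs : Tendsto (fun k => t (φ k)) atTop (𝓝 0) := ht.comp hφt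
  have hyφ : Tendsto (fun k => y (φ k)) atTop (𝓝 ybar) := hyφ
  have hyk := hφt.eventually hy
  -- Comparison of the solutions with the recovery sequences.
  have hupper : ∀ δ > 0, ∃ c : ℕ → ℝ, Tendsto c atTop (𝓝 (-(M / 2) + δ)) ∧
      ∀ᶠ k in atTop, f (φ k) (y (φ k)) ≤ t (φ k) * c k := by
    intro δ hδ
    obtain ⟨a, ha, haΓ⟩ := hrec δ hδ
    have haφ := ha.comp hφt
    have h1 : Tendsto (fun k => ‖a (φ k) - u‖) atTop (𝓝 0) :=
      tendsto_iff_norm_sub_tendsto_zero.1 haφ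
    refine ⟨fun k => M / 2 + δ - v (a (φ k)) + ρ / 2 * ‖a (φ k) - u‖ ^ 2, ?_, ?_⟩
    · have h2 := (((v.continuous.tendsto u).comp haφ).const_sub (M / 2 + δ)).add
        ((h1.pow 2).const_mul (ρ / 2))
      rwa [show M / 2 + δ - v u + ρ / 2 * 0 ^ 2 = -(M / 2) + δ by rw [hvu]; ring] at h2
    · filter_upwards [hyk, hφt.eventually haΓ, h1.eventually (gt_mem_nhds one_pos)]
        with k h2 h3 h4
      refine (h2.2.2 _ h4.le h3.1).trans ?_
      simp only [f]
      linarith [h3.2]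
  have hvy : Tendsto (fun k => v (y (φ k))) atTop (𝓝 (v ybar)) := (v.continuous.tendsto _).comp hyφ
  have hquad : Tendsto (fun k => ρ / 2 * ‖y (φ k) - u‖ ^ 2) atTop (𝓝 (ρ / 2 * ‖ybar - u‖ ^ 2)) :=
    ((hyφ.sub_const u).norm.pow 2).const_mul _
  have hyc : ybar ∈ criticalCone Γ x n := by
    have hT : ybar ∈ tangentCone Γ x :=
      mem_tangentCone_of_eventually hsp hs hyφ (hyk.mono fun k hk => hk.2.1)
    refine ⟨hT, le_antisymm ?_ ?_⟩
    · rw [S.tangentCone_eq] at hT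
      rw [← hnA]
      exact hμ.1 _ hT
    · obtain ⟨c, hc, hfc⟩ := hupper 1 one_pos
      have h1 := hs.mul ((hc.add hvy).sub hquad)
      rw [zero_mul] at h1
      have h2 : Tendsto (fun k => -n (y (φ k))) atTop (𝓝 (-n ybar)) :=
        ((n.continuous.tendsto _).comp hyφ).neg
      have := le_of_tendsto_of_tendsto h2 h1 (hfc.mono fun k hk => by
        simp only [f] at hk
        linarith)
      linarith
  have hq := tendsto_second_order_quotient S.contDiffAt S.map_eq_zero hsp hs hyφ
  -- The lower bound for `-⟨n, y⟩ / t` from `⟨μ, F(x + t y)⟩ ≤ 0`, in the limit.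
  have hlimit : ∀ δ > 0,
      μ ((1 / 2 : ℝ) • B ybar ybar) - v ybar + ρ / 2 * ‖ybar - u‖ ^ 2 ≤ -(M / 2) + δ := by
    intro δ hδ
    obtain ⟨c, hc, hfc⟩ := hupper δ hδ
    refine le_of_tendsto_of_tendsto ((((μ.continuous.tendsto _).comp hq).sub hvy).add hquad) hc ?_
    filter_upwards [hfc, hyk, (tendsto_add_smul_nhds x hs hyφ).eventually S.mem_iff]
      with k h1 h2 h3
    have h4 := hμ.1 _ (h3.1 h2.2.1)
    have hs0 := hsp k
    have h5 : t (φ k) * μ ((t (φ k) ^ 2)⁻¹ •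
        (F (x + t (φ k) • y (φ k)) - t (φ k) • fderiv ℝ F x (y (φ k)))) ≤ -n (y (φ k)) := by
      simp only [map_smul, map_sub, hnA, smul_eq_mul]
      have h6 : (t (φ k))⁻¹ * μ (F (x + t (φ k) • y (φ k))) ≤ 0 :=
        mul_nonpos_of_nonneg_of_nonpos (by positivity) h4
      have h7 : ∀ a b : ℝ, t (φ k) * ((t (φ k) ^ 2)⁻¹ * (a - t (φ k) * b)) =
          (t (φ k))⁻¹ * a - b := fun a b => by field_simp
      rw [h7]
      linarith
    simp only [f] at h1
    simp only [Function.comp_apply]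
    refine le_of_mul_le_mul_left ?_ hs0
    linarith
  have hyu : ybar = u := by
    have h1 := le_of_forall_pos_le_add hlimit
    have h2 : μ (B (ybar - u) (ybar - u)) = μ (B ybar ybar) - 2 * μ (B u ybar) + M := by
      simp only [map_sub, sub_apply, B, M, second_comm S.contDiffAt ybar u]
      ring
    have h3 : -(‖μ‖ * ‖B‖ * ‖ybar - u‖ ^ 2) ≤ μ (B (ybar - u) (ybar - u)) := by
      have h4 : ‖μ (B (ybar - u) (ybar - u))‖ ≤ ‖μ‖ * (‖B‖ * ‖ybar - u‖ * ‖ybar - u‖) :=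
        (μ.le_opNorm _).trans
          (mul_le_mul_of_nonneg_left (B.le_opNorm₂ _ _) (norm_nonneg μ))
      have h5 := (abs_le.1 h4).1
      linarith
    have h6 := hwp ybar hyc
    simp only [map_smul, smul_eq_mul, v, add_apply, ContinuousLinearMap.comp_apply, ρ] at h1
    have h7 : ‖ybar - u‖ ^ 2 ≤ 0 := by linarith
    have h8 : ‖ybar - u‖ = 0 := by
      have := sq_nonneg ‖ybar - u‖
      exact pow_eq_zero_iff (two_ne_zero) |>.1 (le_antisymm h7 this)
    exact sub_eq_zero.1 (norm_eq_zero.1 h8)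
  subst hyu
  refine mem_tangentCone_of_eventually
    (d := fun k => (y (φ k), v - ρ • innerSL ℝ (y (φ k) - ybar))) hsp hs ?_ ?_
  · refine hyφ.prodMk_nhds ?_
    have hc : Continuous fun z : X => v - ρ • innerSL ℝ (z - ybar) := by fun_prop
    simpa using! (hc.tendsto ybar).comp hyφ
  · have h1 : ∀ᶠ k in atTop, ‖y (φ k) - ybar‖ < 1 :=
      (tendsto_iff_norm_sub_tendsto_zero.1 hyφ).eventually (gt_mem_nhds one_pos)
    filter_upwards [hyk, h1] with k h2 h3
    exact regularNormalCone_subset_normalCone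
      (mem_regularNormalCone_of_forall_ge (hsp k) h2.2.1 h3 h2.2.2)

end Sufficiency

/-! ### Second derivatives of compositions -/

section Composition

variable {X Y E : Type*} [NormedAddCommGroup X] [NormedSpace ℝ X] [NormedAddCommGroup Y]
  [NormedSpace ℝ Y] [NormedAddCommGroup E] [NormedSpace ℝ E]

theorem second_comp_apply {g : X → Y} {h : Y → E} {x : X} (hg : ContDiffAt ℝ 2 g x)
    (hh : ContDiffAt ℝ 2 h (g x)) (u v : X) :
    second (fun z => h (g z)) x u v =
      fderiv ℝ h (g x) (second g x u v) + second h (g x) (fderiv ℝ g x u) (fderiv ℝ g x v) := by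
  have hgd : DifferentiableAt ℝ g x := hg.differentiableAt (by norm_num)
  have heq : fderiv ℝ (fun z => h (g z)) =ᶠ[𝓝 x]
      fun z => (fderiv ℝ h (g z)).comp (fderiv ℝ g z) := by
    filter_upwards [eventually_differentiableAt hg,
      hg.continuousAt.eventually (eventually_differentiableAt hh)] with z h1 h2
    exact fderiv_comp z h2 h1
  have h1 : HasFDerivAt (fun z => fderiv ℝ h (g z)) ((second h (g x)).comp (fderiv ℝ g x)) x :=
    HasFDerivAt.comp x (hasFDerivAt_fderiv_second hh) hgd.hasFDerivAt
  have h2 := h1.clm_comp (hasFDerivAt_fderiv_second hg)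
  rw [second, heq.fderiv_eq, h2.fderiv]
  simp

theorem second_clm_comp_apply {g : X → Y} {x : X} (hg : ContDiffAt ℝ 2 g x) (l : Y →L[ℝ] E)
    (u v : X) : second (fun z => l (g z)) x u v = l (second g x u v) := by
  have h0 : second (l : Y → E) (g x) = 0 := by
    have : fderiv ℝ (l : Y → E) = fun _ => l := funext fun y => l.fderiv
    rw [second, this]
    simp
  rw [second_comp_apply hg l.contDiff.contDiffAt, h0, l.fderiv]
  simp

end Composition

/-! ### Reduction to a conic system -/

section Reduction

variable {X Y E : Type*} [NormedAddCommGroup X] [NormedSpace ℝ X] [NormedAddCommGroup Y]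
  [NormedSpace ℝ Y] [NormedAddCommGroup E] [NormedSpace ℝ E]
  {C : Set Y} {y : Y} {K : ProperCone ℝ E} {h : Y → E}

theorem IsC2ConeReduction.contDiffAt (hC : IsC2ConeReduction C y K h) : ContDiffAt ℝ 2 h y := by
  obtain ⟨V, hV, hyV, hh, -⟩ := hC.exists_nhds
  exact hh.contDiffAt (hV.mem_nhds hyV)

/-- The reduction itself is a conic system: as its derivative is surjective, `h` is metrically
regular, so that `dist (z, C) ≤ κ dist (h z, K)` near `y`. -/
theorem IsC2ConeReduction.exists_conicSystem [CompleteSpace Y] [FiniteDimensional ℝ E]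
    (hC : IsC2ConeReduction C y K h) : ∃ κ, ConicSystem C h K y κ := by
  obtain ⟨V, hV, hyV, hh, hCV⟩ := hC.exists_nhds
  have hmem : ∀ z ∈ V, (z ∈ C ↔ h z ∈ K) := fun z hz => by
    have : z ∈ C ∩ V ↔ z ∈ {z | z ∈ V ∧ h z ∈ K} := by rw [hCV]
    simpa [hz] using this
  have hhc : ContDiffAt ℝ 2 h y := hC.contDiffAt
  have hstrict : HasStrictFDerivAt h (fderiv ℝ h y) y := hhc.hasStrictFDerivAt (by norm_num)
  have hsurj : (fderiv ℝ h y).range = ⊤ := LinearMap.range_eq_top.2 hC.surjective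
  set R := (fderiv ℝ h y).nonlinearRightInverseOfSurjective hsurj
  have hR : 0 < R.nnnorm :=
    ContinuousLinearMap.nonlinearRightInverseOfSurjective_nnnorm_pos _ hsurj
  obtain ⟨s, hs, happ⟩ := hstrict.approximates_deriv_on_nhds
    (c := R.nnnorm⁻¹ / 2) (Or.inr (by positivity))
  obtain ⟨r, hr, hball⟩ := Metric.mem_nhds_iff.1 (inter_mem hs (hV.mem_nhds hyV))
  set κ : ℝ := 2 * R.nnnorm
  have hκ : 0 < κ := by positivity
  refine ⟨κ, hhc, hC.map_eq_zero, ?_, hκ.le, ?_⟩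
  · filter_upwards [hV.mem_nhds hyV] with z hz using hmem z hz
  have hsmall : ∀ᶠ z in 𝓝 y, ‖z - y‖ + κ * ‖h z‖ < r := by
    have hc : ContinuousAt (fun z => ‖z - y‖ + κ * ‖h z‖) y :=
      (by fun_prop : ContinuousAt (fun z => ‖z - y‖) y).add
        (hhc.continuousAt.norm.const_mul κ)
    exact hc.tendsto.eventually (gt_mem_nhds (by simpa [hC.map_eq_zero] using hr))
  filter_upwards [hsmall] with z hz
  obtain ⟨k, hk, hdist⟩ := K.isClosed.exists_infDist_eq_dist K.nonempty (h z)
  have hle : dist (h z) k ≤ ‖h z‖ := by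
    rw [← hdist, ← dist_zero_right]
    exact Metric.infDist_le_dist_of_mem K.zero_mem
  have hsub : Metric.closedBall z (κ * dist (h z) k) ⊆ Metric.ball y r := by
    refine Metric.closedBall_subset_ball' ?_
    rw [dist_eq_norm z y]
    linarith [mul_le_mul_of_nonneg_left hle hκ.le]
  -- `κ = 2 ‖R‖` makes the radius in the surjectivity estimate equal to `dist (h z, k)`.
  have hks : k ∈ Metric.closedBall (h z)
      ((((R.nnnorm : ℝ))⁻¹ - (R.nnnorm⁻¹ / 2 : NNReal)) * (κ * dist (h z) k)) := by
    have hR' : (R.nnnorm : ℝ) ≠ 0 := by exact_mod_cast hR.ne'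
    rw [Metric.mem_closedBall, dist_comm]
    refine le_of_eq ?_
    push_cast
    simp only [κ]
    field_simp
    ring
  obtain ⟨z', hz', hhz'⟩ := happ.surjOn_closedBall_of_nonlinearRightInverse R
    (by positivity) (fun a ha => (hball (hsub ha)).1) hks
  have hz'C : z' ∈ C := (hmem z' (hball (hsub hz')).2).2 (hhz' ▸ hk)
  rw [hdist]
  exact (Metric.infDist_le_dist_of_mem hz'C).trans (by rw [dist_comm]; exact hz')

/-- The normal cone to a reducible set is `∇h(y)*` applied to the polar cone of `K`. -/
theorem IsC2ConeReduction.mem_normalCone [CompleteSpace Y] [FiniteDimensional ℝ E]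
    (hC : IsC2ConeReduction C y K h) {l : StrongDual ℝ Y} :
    l ∈ normalCone C y ↔ ∃ μ : StrongDual ℝ E, (∀ k ∈ K, μ k ≤ 0) ∧ μ.comp (fderiv ℝ h y) = l := by
  obtain ⟨κ, S⟩ := hC.exists_conicSystem
  constructor
  · intro hl
    obtain ⟨μ, h1, -, -, h2⟩ := S.eventually_exists_multiplier.self_of_nhds l hl
    exact ⟨μ, h1, h2⟩
  · rintro ⟨μ, hμ, rfl⟩
    refine regularNormalCone_subset_normalCone ⟨S.mem, fun ε hε => ?_⟩
    have hd : HasFDerivAt (fun z => μ (h z)) (μ.comp (fderiv ℝ h y)) y :=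
      μ.hasFDerivAt.comp y (hC.contDiffAt.differentiableAt (by norm_num)).hasFDerivAt
    have h1 := Asymptotics.isLittleO_iff.1 hd.isLittleO hε
    filter_upwards [h1.filter_mono nhdsWithin_le_nhds,
      S.mem_iff.filter_mono nhdsWithin_le_nhds, self_mem_nhdsWithin] with z h2 h3 h4
    have h5 := (abs_le.1 h2).1
    have h6 := hμ _ (h3.1 h4)
    rw [hC.map_eq_zero, map_zero] at h5
    linarith

variable {g : X → Y} {x : X}

theorem exists_conicSystem_preimage [CompleteSpace Y] [FiniteDimensional ℝ E]
    (hg : ContDiffAt ℝ 2 g x) (hC : IsC2ConeReduction C (g x) K h) (hM : MSCQ g C x) :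
    ∃ κ, ConicSystem {z | g z ∈ C} (fun z => h (g z)) K x κ := by
  obtain ⟨κ₁, S⟩ := hC.exists_conicSystem
  obtain ⟨κ, hκ, hdist⟩ := hM
  refine ⟨κ * κ₁, hC.contDiffAt.comp x hg, hC.map_eq_zero,
    hg.continuousAt.eventually S.mem_iff, mul_nonneg hκ S.nonneg, ?_⟩
  filter_upwards [hdist, hg.continuousAt.eventually S.infDist_le] with z h1 h2
  rw [mul_assoc]
  exact h1.trans (mul_le_mul_of_nonneg_left h2 hκ)

theorem mem_multipliers_iff [CompleteSpace Y] [FiniteDimensional ℝ E]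
    (hg : ContDiffAt ℝ 2 g x) (hC : IsC2ConeReduction C (g x) K h) {n : StrongDual ℝ X}
    {l : StrongDual ℝ Y} : l ∈ multipliers g C x n ↔
      ∃ μ ∈ conicMultipliers (fun z => h (g z)) K x n, μ.comp (fderiv ℝ h (g x)) = l := by
  have hcomp : fderiv ℝ (fun z => h (g z)) x = (fderiv ℝ h (g x)).comp (fderiv ℝ g x) :=
    fderiv_comp x (hC.contDiffAt.differentiableAt (by norm_num)) (hg.differentiableAt (by norm_num))
  simp only [multipliers, conicMultipliers, mem_ofPred_eq, hC.mem_normalCone, hcomp]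
  constructor
  · rintro ⟨⟨μ, hμ, rfl⟩, hl⟩
    exact ⟨μ, ⟨hμ, hl⟩, rfl⟩
  · rintro ⟨μ, ⟨hμ, hl⟩, rfl⟩
    exact ⟨⟨μ, hμ, rfl⟩, hl⟩

theorem multiplierObjective_comp (hg : ContDiffAt ℝ 2 g x) (hC : IsC2ConeReduction C (g x) K h)
    (μ : StrongDual ℝ E) (u : X) :
    multiplierObjective g h x u (μ.comp (fderiv ℝ h (g x))) =
      μ (second (fun z => h (g z)) x u u) := by
  rw [multiplierObjective, adjointInv_comp hC.surjective, second_clm_comp_apply hC.contDiffAt,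
    second_comp_apply hg hC.contDiffAt, map_add]
  rfl

theorem second_add_curvature_comp (hg : ContDiffAt ℝ 2 g x)
    (hC : IsC2ConeReduction C (g x) K h) (μ : StrongDual ℝ E) (u : X) :
    (second (fun z => μ.comp (fderiv ℝ h (g x)) (g z)) x +
        curvature g h x (μ.comp (fderiv ℝ h (g x)))) u =
      μ.comp (second (fun z => h (g z)) x u) := by
  ext v
  have hl := second_clm_comp_apply hg (μ.comp (fderiv ℝ h (g x))) u v
  rw [add_apply, add_apply, hl]
  simp only [curvature, adjointInv_comp hC.surjective,
    ContinuousLinearMap.bilinearComp_apply, second_clm_comp_apply hC.contDiffAt,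
    ContinuousLinearMap.comp_apply, second_comp_apply hg hC.contDiffAt,
    map_add]

theorem mem_directionalMultipliers_iff [CompleteSpace Y] [FiniteDimensional ℝ E]
    (hg : ContDiffAt ℝ 2 g x) (hC : IsC2ConeReduction C (g x) K h) {n : StrongDual ℝ X} {u : X}
    {l : StrongDual ℝ Y} : l ∈ directionalMultipliers g h C x n u ↔
      ∃ μ ∈ conicMultipliers (fun z => h (g z)) K x n,
        IsMaxOn (fun μ' : StrongDual ℝ E => μ' (second (fun z => h (g z)) x u u))
          (conicMultipliers (fun z => h (g z)) K x n) μ ∧ μ.comp (fderiv ℝ h (g x)) = l := by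
  constructor
  · rintro ⟨hl, hmax⟩
    obtain ⟨μ, hμ, rfl⟩ := (mem_multipliers_iff hg hC).1 hl
    refine ⟨μ, hμ, fun μ' hμ' => ?_, rfl⟩
    have := hmax ((mem_multipliers_iff hg hC).2 ⟨μ', hμ', rfl⟩)
    simpa only [mem_ofPred_eq, multiplierObjective_comp hg hC] using this
  · rintro ⟨μ, hμ, hmax, rfl⟩
    refine ⟨(mem_multipliers_iff hg hC).2 ⟨μ, hμ, rfl⟩, fun l' hl' => ?_⟩
    obtain ⟨μ', hμ', rfl⟩ := (mem_multipliers_iff hg hC).1 hl'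
    simpa only [mem_ofPred_eq, multiplierObjective_comp hg hC] using hmax hμ'

end Reduction

end GraphDer

end

theorem mainTheorem2
    {X Y E : Type*}
    [NormedAddCommGroup X] [InnerProductSpace ℝ X] [FiniteDimensional ℝ X]
    [NormedAddCommGroup Y] [InnerProductSpace ℝ Y] [FiniteDimensional ℝ Y]
    [NormedAddCommGroup E] [InnerProductSpace ℝ E] [FiniteDimensional ℝ E]
    (g : X → Y) (C : Set Y) (x : X) (n : StrongDual ℝ X)
    (K : ProperCone ℝ E) (h : Y → E)
    (hg : ContDiffAt ℝ 2 g x)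
    (hC : GraphDer.IsC2ConeReduction C (g x) K h)
    (hn : n ∈ GraphDer.normalCone {x' | g x' ∈ C} x)
    (hM : GraphDer.MSCQ g C x) :
    GraphDer.tangentCone (GraphDer.gph (GraphDer.normalCone {x' | g x' ∈ C})) (x, n) =
        {p : X × StrongDual ℝ X | ∃ l ∈ GraphDer.directionalMultipliers g h C x n p.1,
          ∃ w ∈ GraphDer.normalCone (GraphDer.criticalCone {x' | g x' ∈ C} x n) p.1,
            p.2 = (GraphDer.second (fun x' => l (g x')) x + GraphDer.curvature g h x l) p.1 + w} ∧
      ∀ u : X,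
        GraphDer.graphicalDerivative (GraphDer.normalCone {x' | g x' ∈ C}) x n u =
          {v : StrongDual ℝ X | ∃ l ∈ GraphDer.directionalMultipliers g h C x n u,
            ∃ w ∈ GraphDer.normalCone (GraphDer.criticalCone {x' | g x' ∈ C} x n) u,
              v = (GraphDer.second (fun x' => l (g x')) x + GraphDer.curvature g h x l) u + w} := by
  obtain ⟨κ, S⟩ := GraphDer.exists_conicSystem_preimage hg hC hM
  have key : ∀ (u : X) (v : StrongDual ℝ X),
      (u, v) ∈ GraphDer.tangentCone (GraphDer.gph (GraphDer.normalCone {x' | g x' ∈ C})) (x, n) ↔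
        ∃ l ∈ GraphDer.directionalMultipliers g h C x n u,
          ∃ w ∈ GraphDer.normalCone (GraphDer.criticalCone {x' | g x' ∈ C} x n) u,
            v = (GraphDer.second (fun x' => l (g x')) x + GraphDer.curvature g h x l) u + w := by
    intro u v
    constructor
    · intro huv
      obtain ⟨μ, hμ, hmax, hw⟩ := S.exists_multiplier_of_mem_tangentCone_gph huv
      refine ⟨_, (GraphDer.mem_directionalMultipliers_iff hg hC).2 ⟨μ, hμ, hmax, rfl⟩, _, hw, ?_⟩
      rw [GraphDer.second_add_curvature_comp hg hC, add_sub_cancel]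
    · rintro ⟨l, hl, w, hw, rfl⟩
      obtain ⟨μ, hμ, hmax, rfl⟩ := (GraphDer.mem_directionalMultipliers_iff hg hC).1 hl
      rw [GraphDer.second_add_curvature_comp hg hC]
      exact S.mem_tangentCone_gph hμ hmax hw
  exact ⟨Set.ext fun p => key p.1 p.2, fun u => Set.ext fun v => key u v⟩
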